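/- Let $(M,g,I_1,I_2,I_3)$ be a connected hyperkähler manifold of real dimension $4$: $g$ is a Riemannian metric which is Kähler with respect to each of the complex structures $I_1,I_2,I_3$, and $I_1I_2=I_3$. Let $\omega_i=g(I_i\,\cdot,\cdot)$ be the Kähler forms, and let $\omega_i^{-1}$ be the bivectors dual to them. For a unit vector $a\in\mathbb R^3$ put $I_a=a_1I_1+a_2I_2+a_3I_3$. A smooth real bivector field $\Pi$ on $M$ is called *hyper-Poisson* if (i) at every point $\Pi$ is a finite complex linear combination of bivectors each of which is of type $(2,0)$ with respect to some $I_a$, $|a|=1$ (that is, $\Pi$ is a section of the summand $\Lambda^2E\otimes S^2H$ of $\Lambda^2T^{\mathbb C}M$, where $T^{\mathbb C}M=E\otimes H$), and (ii) for every $a$ with $|a|=1$ the $(2,0)$-component of $\Pi$ with respect to $I_a$ is a holomorphic Poisson bivector on $(M,I_a)$. A smooth vector field $X$ on $M$ is called *tri-Hamiltonian* if there are smooth functions $\mu_1,\mu_2,\mu_3:M\to\mathbb R$, called moment maps of $X$, with $d\mu_i=\omega_i(X,\cdot)$ for $i=1,2,3$. Then $M$ admits a hyper-Poisson bivector which is not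 of the form $c_1\omega_1^{-1}+c_2\omega_2^{-1}+c_3\omega_3^{-1}$ with constants $c_1,c_2,c_3\in\mathbb R$ if and only if $M$ admits a tri-Hamiltonian vector field which is not identically zero. More precisely: 1. If $\Pi$ is a hyper-Poisson bivector which is not such a constant linear combination, then there are unique functions $f_1,f_2,f_3:M\to\mathbb R$ with $\Pi=f_1\omega_1^{-1}+f_2\omega_2^{-1}+f_3\omega_3^{-1}$, these functions are smooth, and there is a unique non-zero tri-Hamiltonian vector field $X$ on $M$ with moment maps $f_1,f_2,f_3$. 2. Conversely, if $X$ is a non-zero tri-Hamiltonian vector field on $M$ with moment maps $f_1,f_2,f_3$, then $f_1\omega_1^{-1}+f_2\omega_2^{-1}+f_3\omega_3^{-1}$ is a hyper-Poisson bivector, and it is not a constant linear combination of $\omega_1^{-1},\omega_2^{-1},\omega_3^{-1}$. -/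

import Mathlib

open scoped Manifold ContDiff Topology

noncomputable section

namespace HyperPoisson

/-! ### Bivectors on a vector space

A bivector on a finite-dimensional real vector space `V` is an alternating bilinear form `B` on the
dual `V →L[ℝ] ℝ`. It is given by the linear map `B♯ : V* → V` with `B(α, β) = α(B♯ β)`; that `B` is
alternating means `α(B♯ α) = 0` for all `α`. A complex bivector (an element of
`Λ² V ⊗ ℂ`) is an alternating `ℂ`-bilinear form on the space `V →L[ℝ] ℂ` of complex covectors. -/

section LinearAlgebra

variable {V : Type*} [AddCommGroup V] [Module ℝ V] [TopologicalSpace V]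

/-- Real part of a complex covector. -/
def reCovector (α : V →L[ℝ] ℂ) : V →L[ℝ] ℝ := Complex.reCLM.comp α

/-- Imaginary part of a complex covector. -/
def imCovector (α : V →L[ℝ] ℂ) : V →L[ℝ] ℝ := Complex.imCLM.comp α

variable [IsTopologicalAddGroup V] [ContinuousSMul ℝ V]

/-- The `ℂ`-bilinear extension to complex covectors of the bilinear form `(α, β) ↦ α(B β)` on
covectors. -/
def complexify (B : (V →L[ℝ] ℝ) →L[ℝ] V) :
    (V →L[ℝ] ℂ) →ₗ[ℂ] (V →L[ℝ] ℂ) →ₗ[ℂ] ℂ :=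
  have re_add : ∀ α β : V →L[ℝ] ℂ, reCovector (α + β) = reCovector α + reCovector β :=
    fun α β => by ext v; simp [reCovector]
  have im_add : ∀ α β : V →L[ℝ] ℂ, imCovector (α + β) = imCovector α + imCovector β :=
    fun α β => by ext v; simp [imCovector]
  have re_smul : ∀ (c : ℂ) (α : V →L[ℝ] ℂ),
      reCovector (c • α) = c.re • reCovector α - c.im • imCovector α :=
    fun c α => by ext v; simp [reCovector, imCovector]
  have im_smul : ∀ (c : ℂ) (α : V →L[ℝ] ℂ),
      imCovector (c • α) = c.re • imCovector α + c.im • reCovector α :=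
    fun c α => by ext v; simp [reCovector, imCovector]
  LinearMap.mk₂ ℂ
    (fun α β =>
      (⟨reCovector α (B (reCovector β)) - imCovector α (B (imCovector β)),
        reCovector α (B (imCovector β)) + imCovector α (B (reCovector β))⟩ : ℂ))
    (fun α α' β => by apply Complex.ext <;> simp [re_add, im_add] <;> ring)
    (fun c α β => by apply Complex.ext <;> simp [re_smul, im_smul] <;> ring)
    (fun α β β' => by apply Complex.ext <;> simp [re_add, im_add] <;> ring)
    (fun c α β => by apply Complex.ext <;> simp [re_smul, im_smul] <;> ring)

/-- For a complex structure `J` on `V`, the transpose of the projection `½(1 - iJ)` of `V ⊗ ℂ` onto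
the space of vectors of type `(1,0)`. -/
def oneZeroPart (J : V →L[ℝ] V) : (V →L[ℝ] ℂ) →ₗ[ℂ] (V →L[ℝ] ℂ) where
  toFun α := (1 / 2 : ℂ) • (α - Complex.I • α.comp J)
  map_add' α β := by ext v; simp; ring
  map_smul' c α := by ext v; simp; ring

/-- The `(2,0)`-component, with respect to `J`, of a real bivector. -/
def twoZeroPart (J : V →L[ℝ] V) (B : (V →L[ℝ] ℝ) →L[ℝ] V) :
    (V →L[ℝ] ℂ) →ₗ[ℂ] (V →L[ℝ] ℂ) →ₗ[ℂ] ℂ :=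
  (complexify B).compl₁₂ (oneZeroPart J) (oneZeroPart J)

/-- `C` is a complex bivector of type `(2,0)` with respect to `J`: it is alternating and lies in
`Λ²` of the `i`-eigenspace of `J`. -/
def IsTypeTwoZero (J : V →L[ℝ] V) (C : (V →L[ℝ] ℂ) →ₗ[ℂ] (V →L[ℝ] ℂ) →ₗ[ℂ] ℂ) : Prop :=
  C.IsAlt ∧ ∀ α β : V →L[ℝ] ℂ, C (α.comp J) β = Complex.I * C α β

/-- The complex structure `a₀ J₀ + a₁ J₁ + a₂ J₂` of a quaternionic triple. -/
def combination (J : Fin 3 → V →L[ℝ] V) (a : Fin 3 → ℝ) : V →L[ℝ] V := ∑ i, a i • J i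

/-- The space `Λ²E ⊗ S²H` inside `Λ² V ⊗ ℂ`, that is, the space of finite linear combinations of
bivectors that are of type `(2,0)` for some complex structure `a₀ J₀ + a₁ J₁ + a₂ J₂`, `|a| = 1`. -/
def salamonComponent (J : Fin 3 → V →L[ℝ] V) :
    Submodule ℂ ((V →L[ℝ] ℂ) →ₗ[ℂ] (V →L[ℝ] ℂ) →ₗ[ℂ] ℂ) :=
  Submodule.span ℂ
    {C | ∃ a : Fin 3 → ℝ, ∑ i, a i ^ 2 = 1 ∧ IsTypeTwoZero (combination J a) C}

/-- The bivector `w⁻¹` dual to a nondegenerate alternating form `w`. If `♭ : V → V*` is the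
isomorphism `u ↦ w(u, ·)`, then `w⁻¹(α, β) = w(♭⁻¹ α, ♭⁻¹ β) = α(♭⁻¹ β)`, so the linear map that
represents it is `♭⁻¹`. -/
def dualBivector (w : V →L[ℝ] V →L[ℝ] ℝ) : (V →L[ℝ] ℝ) →L[ℝ] V := w.inverse

end LinearAlgebra

/-! ### Tensor fields on a manifold -/

section Manifold

variable {E : Type*} [NormedAddCommGroup E] [NormedSpace ℝ E]
  {M : Type*} [TopologicalSpace M] [ChartedSpace E M]

/-- `F` is a holomorphic function on the set `U` with respect to the almost complex structure
`J`. -/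
def IsHolomorphicOn (J : ∀ x : M, TangentSpace 𝓘(ℝ, E) x →L[ℝ] TangentSpace 𝓘(ℝ, E) x)
    (U : Set M) (F : M → ℂ) : Prop :=
  ContMDiffOn 𝓘(ℝ, E) 𝓘(ℝ, ℂ) ∞ F U ∧
    ∀ x ∈ U, ∀ v : TangentSpace 𝓘(ℝ, E) x,
      mvfderiv 𝓘(ℝ, E) F x (J x v) = Complex.I * mvfderiv 𝓘(ℝ, E) F x v

/-- `J` is a complex structure: around every point there are holomorphic coordinates, i.e. a
diffeomorphism from an open neighbourhood onto an open subset of `ℂⁿ` with `J`-holomorphic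
components. -/
def IsComplexStructure
    (J : ∀ x : M, TangentSpace 𝓘(ℝ, E) x →L[ℝ] TangentSpace 𝓘(ℝ, E) x) : Prop :=
  ∀ p : M, ∃ (n : ℕ) (φ : OpenPartialHomeomorph M (Fin n → ℂ)), p ∈ φ.source ∧
    (∀ k, IsHolomorphicOn J φ.source (fun x => φ x k)) ∧
    ContMDiffOn 𝓘(ℝ, Fin n → ℂ) 𝓘(ℝ, E) ∞ φ.symm φ.target

/-- The bracket `{F, G} = C(dF, dG)` of complex functions defined by a complex bivector field. -/
def bracket (C : ∀ x : M, (TangentSpace 𝓘(ℝ, E) x →L[ℝ] ℂ) →ₗ[ℂ]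
      (TangentSpace 𝓘(ℝ, E) x →L[ℝ] ℂ) →ₗ[ℂ] ℂ) (F G : M → ℂ) : M → ℂ :=
  fun x => C x (mvfderiv 𝓘(ℝ, E) F x) (mvfderiv 𝓘(ℝ, E) G x)

/-- `C` is a holomorphic Poisson bivector on `(M, J)`: it is of type `(2,0)` and its bracket makes
the sheaf of `J`-holomorphic functions a sheaf of Poisson algebras. (Bilinearity, antisymmetry and
the Leibniz rule hold for the bracket of any bivector. Evaluating on holomorphic coordinates, the
first condition on brackets says that the coefficients of `C` are holomorphic, the second that the
Schouten bracket `[C, C]` vanishes.) -/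
structure IsHolomorphicPoisson
    (J : ∀ x : M, TangentSpace 𝓘(ℝ, E) x →L[ℝ] TangentSpace 𝓘(ℝ, E) x)
    (C : ∀ x : M, (TangentSpace 𝓘(ℝ, E) x →L[ℝ] ℂ) →ₗ[ℂ]
      (TangentSpace 𝓘(ℝ, E) x →L[ℝ] ℂ) →ₗ[ℂ] ℂ) : Prop where
  type_two_zero : ∀ x, IsTypeTwoZero (J x) (C x)
  holomorphic : ∀ (U : Set M) (F G : M → ℂ), IsOpen U →
    IsHolomorphicOn J U F → IsHolomorphicOn J U G → IsHolomorphicOn J U (bracket C F G)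
  jacobi : ∀ (U : Set M) (F G H : M → ℂ), IsOpen U →
    IsHolomorphicOn J U F → IsHolomorphicOn J U G → IsHolomorphicOn J U H → ∀ x ∈ U,
      bracket C F (bracket C G H) x + bracket C G (bracket C H F) x
        + bracket C H (bracket C F G) x = 0

variable [IsManifold 𝓘(ℝ, E) ∞ M]

/-- A smooth vector field. -/
def IsSmoothVectorField (X : ∀ x : M, TangentSpace 𝓘(ℝ, E) x) : Prop :=
  ContMDiff 𝓘(ℝ, E) (𝓘(ℝ, E).prod 𝓘(ℝ, E)) ∞
    (fun x => (Bundle.TotalSpace.mk' E x (X x) : TangentBundle 𝓘(ℝ, E) M))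

/-- A vector field that is smooth on the set `U`. -/
def IsSmoothVectorFieldOn (U : Set M) (X : ∀ x : M, TangentSpace 𝓘(ℝ, E) x) : Prop :=
  ContMDiffOn 𝓘(ℝ, E) (𝓘(ℝ, E).prod 𝓘(ℝ, E)) ∞
    (fun x => (Bundle.TotalSpace.mk' E x (X x) : TangentBundle 𝓘(ℝ, E) M)) U

/-- A smooth field of endomorphisms of the tangent bundle. -/
def IsSmoothEndomorphism
    (J : ∀ x : M, TangentSpace 𝓘(ℝ, E) x →L[ℝ] TangentSpace 𝓘(ℝ, E) x) : Prop :=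
  ContMDiff 𝓘(ℝ, E) (𝓘(ℝ, E).prod 𝓘(ℝ, E →L[ℝ] E)) ∞
    (fun x => Bundle.TotalSpace.mk' (E →L[ℝ] E)
      (E := fun x : M => TangentSpace 𝓘(ℝ, E) x →L[ℝ] TangentSpace 𝓘(ℝ, E) x) x (J x))

/-- A smooth bivector field, i.e. a smooth section of `Λ² TM`. -/
def IsSmoothBivector
    (P : ∀ x : M, (TangentSpace 𝓘(ℝ, E) x →L[ℝ] ℝ) →L[ℝ] TangentSpace 𝓘(ℝ, E) x) : Prop :=
  (∀ (x : M) (α : TangentSpace 𝓘(ℝ, E) x →L[ℝ] ℝ), α (P x α) = 0) ∧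
  ContMDiff 𝓘(ℝ, E) (𝓘(ℝ, E).prod 𝓘(ℝ, (E →L[ℝ] ℝ) →L[ℝ] E)) ∞
    (fun x => Bundle.TotalSpace.mk' ((E →L[ℝ] ℝ) →L[ℝ] E)
      (E := fun x : M => (TangentSpace 𝓘(ℝ, E) x →L[ℝ] ℝ) →L[ℝ] TangentSpace 𝓘(ℝ, E) x) x (P x))

/-- The exterior derivative `dw(X, Y, Z)` of a 2-form, by Cartan's formula. -/
def extDerivTwoForm
    (w : ∀ x : M, TangentSpace 𝓘(ℝ, E) x →L[ℝ] TangentSpace 𝓘(ℝ, E) x →L[ℝ] ℝ)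
    (X Y Z : ∀ x : M, TangentSpace 𝓘(ℝ, E) x) (x : M) : ℝ :=
  mvfderiv 𝓘(ℝ, E) (fun y => w y (Y y) (Z y)) x (X x)
    + mvfderiv 𝓘(ℝ, E) (fun y => w y (Z y) (X y)) x (Y x)
    + mvfderiv 𝓘(ℝ, E) (fun y => w y (X y) (Y y)) x (Z x)
    - w x (VectorField.mlieBracket 𝓘(ℝ, E) X Y x) (Z x)
    - w x (VectorField.mlieBracket 𝓘(ℝ, E) Y Z x) (X x)
    - w x (VectorField.mlieBracket 𝓘(ℝ, E) Z X x) (Y x)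

/-- The 2-form `w` is closed. -/
def IsClosedTwoForm
    (w : ∀ x : M, TangentSpace 𝓘(ℝ, E) x →L[ℝ] TangentSpace 𝓘(ℝ, E) x →L[ℝ] ℝ) : Prop :=
  ∀ (U : Set M) (X Y Z : ∀ x : M, TangentSpace 𝓘(ℝ, E) x), IsOpen U →
    IsSmoothVectorFieldOn U X → IsSmoothVectorFieldOn U Y → IsSmoothVectorFieldOn U Z →
    ∀ x ∈ U, extDerivTwoForm w X Y Z x = 0

/-! ### Hyperkähler manifolds -/

variable (E M) in
/-- A hyperkähler structure `(g, J₀, J₁, J₂)`: a Riemannian metric that is Kähler with respect to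
each of three complex structures satisfying the quaternionic relations. -/
structure HyperkahlerStructure where
  /-- the Riemannian metric -/
  g : Bundle.ContMDiffRiemannianMetric 𝓘(ℝ, E) ∞ E (fun x : M => TangentSpace 𝓘(ℝ, E) x)
  /-- the three complex structures -/
  J : Fin 3 → ∀ x : M, TangentSpace 𝓘(ℝ, E) x →L[ℝ] TangentSpace 𝓘(ℝ, E) x
  smooth_J : ∀ i, IsSmoothEndomorphism (J i)
  J_sq : ∀ i x v, J i x (J i x v) = -v
  J_mul : ∀ x v, J 0 x (J 1 x v) = J 2 x v
  integrable : ∀ i, IsComplexStructure (J i)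
  hermitian : ∀ i x u v, g.inner x (J i x u) (J i x v) = g.inner x u v
  closed : ∀ i, IsClosedTwoForm (fun x => (g.inner x).comp (J i x))

namespace HyperkahlerStructure

variable (S : HyperkahlerStructure E M)

/-- The Kähler form `ωᵢ(u, v) = g(Jᵢ u, v)`. -/
def kahlerForm (i : Fin 3) (x : M) :
    TangentSpace 𝓘(ℝ, E) x →L[ℝ] TangentSpace 𝓘(ℝ, E) x →L[ℝ] ℝ :=
  (S.g.inner x).comp (S.J i x)

/-- The bivector field `f₀ ω₀⁻¹ + f₁ ω₁⁻¹ + f₂ ω₂⁻¹`. -/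
def bivectorOf (f : Fin 3 → M → ℝ) (x : M) :
    (TangentSpace 𝓘(ℝ, E) x →L[ℝ] ℝ) →L[ℝ] TangentSpace 𝓘(ℝ, E) x :=
  ∑ i, f i x • dualBivector (S.kahlerForm i x)

/-- `P` is a hyper-Poisson bivector: a real bivector field with values in `Λ²E ⊗ S²H` whose
`(2,0)`-component with respect to every complex structure `a₀ J₀ + a₁ J₁ + a₂ J₂`, `|a| = 1`, is a
holomorphic Poisson bivector for that structure. -/
structure IsHyperPoisson
    (P : ∀ x : M, (TangentSpace 𝓘(ℝ, E) x →L[ℝ] ℝ) →L[ℝ] TangentSpace 𝓘(ℝ, E) x) : Prop where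
  smooth : IsSmoothBivector P
  mem_component : ∀ x, complexify (P x) ∈ salamonComponent (fun i => S.J i x)
  holomorphicPoisson : ∀ a : Fin 3 → ℝ, ∑ i, a i ^ 2 = 1 →
    IsHolomorphicPoisson (fun x => combination (fun i => S.J i x) a)
      (fun x => twoZeroPart (combination (fun i => S.J i x) a) (P x))

/-- `P` is a linear combination of `ω₀⁻¹, ω₁⁻¹, ω₂⁻¹` with constant coefficients. -/
def IsConstantCombination
    (P : ∀ x : M, (TangentSpace 𝓘(ℝ, E) x →L[ℝ] ℝ) →L[ℝ] TangentSpace 𝓘(ℝ, E) x) : Prop :=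
  ∃ c : Fin 3 → ℝ, P = S.bivectorOf (fun i _ => c i)

/-- The smooth functions `μ₀, μ₁, μ₂` are moment maps of `X` for `ω₀, ω₁, ω₂`, i.e.
`dμᵢ = ωᵢ(X, ·)`. -/
def AreMomentMaps (X : ∀ x : M, TangentSpace 𝓘(ℝ, E) x) (μ : Fin 3 → M → ℝ) : Prop :=
  ∀ i, ContMDiff 𝓘(ℝ, E) 𝓘(ℝ, ℝ) ∞ (μ i) ∧
    ∀ x, mvfderiv 𝓘(ℝ, E) (μ i) x = S.kahlerForm i x (X x)

/-- A tri-Hamiltonian vector field: a smooth vector field that is Hamiltonian with respect to each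
of the three Kähler forms. -/
def IsTriHamiltonian (X : ∀ x : M, TangentSpace 𝓘(ℝ, E) x) : Prop :=
  IsSmoothVectorField X ∧ ∃ μ : Fin 3 → M → ℝ, S.AreMomentMaps X μ

end HyperkahlerStructure

end Manifold

end HyperPoisson

end

/-! Write `J 0`, `J 1`, `J 2` for the three complex structures and `ω₀`, `ω₁`, `ω₂` for their Kähler
forms.

Pointwise part. A bivector `C` of type (2,0) for some `I_a` satisfies `∑ C(α ∘ Jᵢ, β ∘ Jᵢ) = -C(α,
β)`, hence so does every element of `Λ²E ⊗ S²H`. In real dimension 4 this relation leaves three free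
real parameters, so a real bivector in that summand is `∑ fᵢ ωᵢ⁻¹` with unique `fᵢ`
(`exists_eq_sum_dualBivector`, `coefficient_eq`). On (1,0)-covectors of `J 0` the term `ω₀⁻¹`
vanishes and `ω₂⁻¹ = i ω₁⁻¹`, so the (2,0)-part is `(f₁ + i f₂) ω₁⁻¹`
(`twoZeroPart_sum_dualBivector`).

Analytic part. Put `ω = ω₁ + i ω₂` and `{F, G} = ω₁⁻¹(dF, dG)`. For `J 0`-holomorphic `F`, `G` one
has `dF ∧ dG = ½ {F, G} ω`. Since `ω` is closed, differentiating gives `d{F, G} ∧ ω = 0`, which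
forces `{F, G}` to be holomorphic (`isHolomorphicOn_pairing`). The Jacobi identity is automatic
because three (1,0)-covectors in complex dimension 2 are dependent (`pairing_jacobi`). Thus if `f₁ +
i f₂` is holomorphic, the (2,0)-part is holomorphic Poisson; conversely, in holomorphic coordinates
`f₁ + i f₂` is locally a quotient of holomorphic brackets. Only this converse uses integrability, so
the rest is done for a `ClosedTriple`, whose structures are merely almost complex; this allows
rotation to an arbitrary `I_a` without proving `I_a` integrable.

Conclusion. If the `fᵢ` are moment maps of `X`, then for an oriented orthonormal frame `a, b, c` the
form `d(f_b + i f_c) = g(I_b X, ·) + i g(I_c X, ·)` is of type (1,0) for `I_a`, so the bivector is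
hyper-Poisson. Conversely, let `X` be the `ω₀`-Hamiltonian field of `f₀`; the Cauchy-Riemann
equations for `J 2` and `J 0` say that `f₁` and `f₂` are its other moment maps. On a connected
manifold `X = 0` exactly when the `fᵢ` are constant. -/

noncomputable section

namespace HyperPoisson

/-! ### Hyperhermitian vector spaces -/

section LinearAlgebra

variable {V : Type*} [AddCommGroup V] [Module ℝ V] [TopologicalSpace V]

/-- `g` is an inner product that is Hermitian for the quaternionic triple `J`. -/
structure IsHyperhermitian (g : V →L[ℝ] V →L[ℝ] ℝ) (J : Fin 3 → V →L[ℝ] V) : Prop where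
  symm : ∀ u v, g u v = g v u
  pos : ∀ v, v ≠ 0 → 0 < g v v
  sq : ∀ i v, J i (J i v) = -v
  mul : ∀ v, J 0 (J 1 v) = J 2 v
  hermitian : ∀ i u v, g (J i u) (J i v) = g u v

namespace IsHyperhermitian

variable {g : V →L[ℝ] V →L[ℝ] ℝ} {J : Fin 3 → V →L[ℝ] V} (h : IsHyperhermitian g J)

include h

/-- Anticommutation is not assumed: it follows from `J 2 = J 0 ∘ J 1` squaring to `-1`, by
cancelling `J 0` on the left and `J 1` on the right in `J₀J₁J₀J₁ = -1`. -/
theorem mul_one_zero (v : V) : J 1 (J 0 v) = -J 2 v := by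
  have h4 : ∀ w, J 1 (J 0 w) = -J 0 (J 1 w) := by
    intro w
    have h5 : J 1 (J 0 (J 1 (J 1 w))) = J 0 (J 1 w) := by
      have h2 : J 0 (J 1 (J 0 (J 1 (J 1 w)))) = -J 1 w := by rw [h.mul, h.mul, h.sq]
      have h3 := congrArg (J 0) h2
      rw [h.sq, map_neg] at h3
      exact neg_injective h3
    rw [h.sq, map_neg, map_neg] at h5
    rw [← h5, neg_neg]
  rw [h4, h.mul]

theorem mul_zero_two (v : V) : J 0 (J 2 v) = -J 1 v := by rw [← h.mul, h.sq]

theorem mul_two_zero (v : V) : J 2 (J 0 v) = J 1 v := by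
  rw [← h.mul, h.mul_one_zero, map_neg, h.mul_zero_two, neg_neg]

theorem mul_two_one (v : V) : J 2 (J 1 v) = -J 0 v := by rw [← h.mul, h.sq, map_neg]

theorem mul_one_two (v : V) : J 1 (J 2 v) = J 0 v := by
  rw [← h.mul, h.mul_one_zero, h.mul_two_one, neg_neg]

theorem skew (i : Fin 3) (u v : V) : g (J i u) v = -g u (J i v) := by
  rw [← h.hermitian i u (J i v), h.sq]; simp

theorem apply_self (i : Fin 3) (u : V) : g (J i u) u = 0 := by
  have := h.skew i u u
  rw [h.symm u] at this
  linarith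

theorem apply_self' (i : Fin 3) (u : V) : g u (J i u) = 0 := by
  rw [h.symm, h.apply_self]

theorem eq_zero_of_flat {v : V} (hv : ∀ u, g v u = 0) : v = 0 := by
  by_contra h0
  exact (h.pos v h0).ne' (hv v)

theorem flat_injective : Function.Injective g := by
  intro u v huv
  rw [← sub_eq_zero]
  refine h.eq_zero_of_flat fun w => ?_
  simp [huv]

theorem form_injective (i : Fin 3) : Function.Injective (g.comp (J i)) := by
  intro u v huv
  have h1 : J i u = J i v := h.flat_injective huv
  have h2 := congrArg (J i) h1
  rw [h.sq, h.sq] at h2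
  exact neg_injective h2

theorem apply_basis {i j : Fin 3} (hij : i ≠ j) (v : V) : g (J i v) (J j v) = 0 := by
  rw [h.skew]
  fin_cases i <;> fin_cases j <;> first
    | exact absurd rfl hij
    | simp [h.mul, h.mul_one_zero, h.mul_one_two, h.mul_two_one, h.mul_zero_two, h.mul_two_zero,
        h.apply_self']

/-- A vector of a hyperhermitian vector space of dimension 4 in the basis `v, J₀ v, J₁ v, J₂ v`. -/
theorem expansion [FiniteDimensional ℝ V] (hd : Module.finrank ℝ V = 4) {v : V} (hv : g v v = 1)
    (u : V) : u = g v u • v + g (J 0 v) u • J 0 v + g (J 1 v) u • J 1 v + g (J 2 v) u • J 2 v := by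
  have c01 := h.apply_basis (i := 0) (j := 1) (by decide) v
  have c02 := h.apply_basis (i := 0) (j := 2) (by decide) v
  have c12 := h.apply_basis (i := 1) (j := 2) (by decide) v
  have c10 := h.apply_basis (i := 1) (j := 0) (by decide) v
  have c20 := h.apply_basis (i := 2) (j := 0) (by decide) v
  have c21 := h.apply_basis (i := 2) (j := 1) (by decide) v
  let e : Fin 4 → V := ![v, J 0 v, J 1 v, J 2 v]
  have key : ∀ c : Fin 4 → ℝ, ∑ i, c i • e i = c 0 • v + c 1 • J 0 v + c 2 • J 1 v + c 3 • J 2 v :=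
    fun c => by simp [e, Fin.sum_univ_four]
  have li : LinearIndependent ℝ e := by
    rw [Fintype.linearIndependent_iff]
    intro c hc
    rw [key] at hc
    have k : ∀ w, g w (c 0 • v + c 1 • J 0 v + c 2 • J 1 v + c 3 • J 2 v) = 0 := by
      intro w; rw [hc, map_zero]
    have k0 := k v
    have k1 := k (J 0 v)
    have k2 := k (J 1 v)
    have k3 := k (J 2 v)
    simp only [map_add, map_smul, smul_eq_mul, h.apply_self, h.apply_self', h.hermitian, hv, c01,
      c02, c12, c10, c20, c21] at k0 k1 k2 k3
    intro i
    fin_cases i <;> simp <;> linarith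
  have hs : u ∈ Submodule.span ℝ (Set.range e) := by
    rw [li.span_eq_top_of_card_eq_finrank (by simp [hd])]
    trivial
  obtain ⟨c, hc⟩ := (Submodule.mem_span_range_iff_exists_fun ℝ).1 hs
  rw [key] at hc
  subst hc
  simp [h.apply_self, h.apply_self', h.hermitian, hv, c01, c02, c12, c10, c20, c21]

theorem exists_unit (hd : Module.finrank ℝ V = 4) : ∃ v, g v v = 1 := by
  have : Nontrivial V := Module.nontrivial_of_finrank_pos (R := ℝ) (by omega)
  obtain ⟨w, hw⟩ := exists_ne (0 : V)
  have hp := h.pos w hw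
  refine ⟨(Real.sqrt (g w w))⁻¹ • w, ?_⟩
  have hs := Real.mul_self_sqrt hp.le
  have : Real.sqrt (g w w) ≠ 0 := (Real.sqrt_pos.2 hp).ne'
  simp only [map_smul, smul_apply, smul_eq_mul]
  field_simp
  rw [_root_.sq, hs]

variable [IsTopologicalAddGroup V] [ContinuousSMul ℝ V] [T2Space V] [FiniteDimensional ℝ V]

omit h in
theorem finrank_dual : Module.finrank ℝ V = Module.finrank ℝ (V →L[ℝ] ℝ) := by
  rw [← (LinearMap.toContinuousLinearMap (𝕜 := ℝ) (E := V) (F' := ℝ)).finrank_eq,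
    ← Subspace.dual_finrank_eq]

omit h in
-- `dualBivector` is defined through `inverse`, which is zero on non-invertible maps, so
-- invertibility of the Kähler forms must be known before anything can be computed.
theorem isInvertible_of_injective {w : V →L[ℝ] V →L[ℝ] ℝ} (hw : Function.Injective w) :
    w.IsInvertible := by
  have : FiniteDimensional ℝ (V →L[ℝ] ℝ) :=
    LinearEquiv.finiteDimensional (LinearMap.toContinuousLinearMap (𝕜 := ℝ) (E := V) (F' := ℝ))
  exact ⟨(LinearEquiv.ofInjectiveOfFinrankEq w.toLinearMap hw
    finrank_dual).toContinuousLinearEquiv, by ext; rfl⟩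

theorem exists_flat (β : V →L[ℝ] ℝ) : ∃ b, g b = β := by
  obtain ⟨e, he⟩ := isInvertible_of_injective h.flat_injective
  exact ⟨e.symm β, by rw [← he]; simp⟩

/-- Since `ωᵢ(-Jᵢ b, ·) = g(b, ·)`. Identifying covectors with vectors through `g` turns `ωᵢ⁻¹` into
`-Jᵢ`, and all later computations take place on that side. -/
theorem dualBivector_flat (i : Fin 3) (b : V) : dualBivector (g.comp (J i)) (g b) = -J i b := by
  obtain ⟨e, he⟩ := isInvertible_of_injective (h.form_injective i)
  rw [dualBivector, ← he, ContinuousLinearMap.inverse_equiv]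
  have : g b = e (-J i b) := by
    change g b = (e : V →L[ℝ] V →L[ℝ] ℝ) (-J i b)
    rw [he]
    simp [h.sq]
  rw [this]
  simp

end IsHyperhermitian

end LinearAlgebra

/-! ### Bivectors on hyperhermitian vector spaces -/

section LinearAlgebra

set_option linter.unusedSectionVars false

variable {V : Type*} [AddCommGroup V] [Module ℝ V] [TopologicalSpace V]
  [IsTopologicalAddGroup V] [ContinuousSMul ℝ V]

theorem complexify_apply (B : (V →L[ℝ] ℝ) →L[ℝ] V) (α β : V →L[ℝ] ℂ) :
    complexify B α β =
      (⟨reCovector α (B (reCovector β)) - imCovector α (B (imCovector β)),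
        reCovector α (B (imCovector β)) + imCovector α (B (reCovector β))⟩ : ℂ) := rfl

theorem complexify_add (B B' : (V →L[ℝ] ℝ) →L[ℝ] V) :
    complexify (B + B') = complexify B + complexify B' := by
  ext α β
  apply Complex.ext <;> simp [complexify_apply] <;> ring

theorem complexify_smul (c : ℝ) (B : (V →L[ℝ] ℝ) →L[ℝ] V) :
    complexify (c • B) = (c : ℂ) • complexify B := by
  ext α β
  apply Complex.ext <;> simp [complexify_apply] <;> ring

theorem oneZeroPart_apply (J : V →L[ℝ] V) (α : V →L[ℝ] ℂ) :
    oneZeroPart J α = (1 / 2 : ℂ) • (α - Complex.I • α.comp J) := rfl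

theorem twoZeroPart_apply (J : V →L[ℝ] V) (B : (V →L[ℝ] ℝ) →L[ℝ] V) (α β : V →L[ℝ] ℂ) :
    twoZeroPart J B α β = complexify B (oneZeroPart J α) (oneZeroPart J β) := rfl

theorem oneZeroPart_of_oneZero {J : V →L[ℝ] V} {α : V →L[ℝ] ℂ}
    (hα : ∀ v, α (J v) = Complex.I * α v) : oneZeroPart J α = α := by
  ext v
  simp only [oneZeroPart_apply, smul_apply, sub_apply,
    ContinuousLinearMap.comp_apply, hα, smul_eq_mul]
  linear_combination (-1 / 2 * α v) * Complex.I_sq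

theorem isAlt_complexify {B : (V →L[ℝ] ℝ) →L[ℝ] V} (hB : ∀ α : V →L[ℝ] ℝ, α (B α) = 0) :
    (complexify B).IsAlt := by
  have hs : ∀ α β : V →L[ℝ] ℝ, α (B β) = -β (B α) := by
    intro α β
    have := hB (α + β)
    simp only [map_add, add_apply, hB] at this
    linarith
  intro α
  rw [complexify_apply]
  apply Complex.ext
  · simp [hB]
  · simp [hs (reCovector α) (imCovector α)]

theorem isTypeTwoZero_twoZeroPart {J : V →L[ℝ] V} (hJ : ∀ v, J (J v) = -v)
    {B : (V →L[ℝ] ℝ) →L[ℝ] V} (hB : ∀ α : V →L[ℝ] ℝ, α (B α) = 0) : IsTypeTwoZero J (twoZeroPart J B) := by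
  refine ⟨fun α => isAlt_complexify hB _, fun α β => ?_⟩
  have : oneZeroPart J (α.comp J) = Complex.I • oneZeroPart J α := by
    ext v
    simp only [oneZeroPart_apply, smul_apply, sub_apply,
      ContinuousLinearMap.comp_apply, hJ, smul_eq_mul, map_neg]
    linear_combination (1 / 2 * α (J v)) * Complex.I_sq
  rw [twoZeroPart_apply, twoZeroPart_apply, this, map_smul, LinearMap.smul_apply, smul_eq_mul]

theorem combination_apply (J : Fin 3 → V →L[ℝ] V) (a : Fin 3 → ℝ) (v : V) :
    combination J a v = a 0 • J 0 v + a 1 • J 1 v + a 2 • J 2 v := by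
  simp [combination, Fin.sum_univ_three]

namespace IsHyperhermitian

variable {g : V →L[ℝ] V →L[ℝ] ℝ} {J : Fin 3 → V →L[ℝ] V} (h : IsHyperhermitian g J)

include h

/-- The action of the quaternionic Casimir operator on `Λ²E ⊗ S²H`. -/
theorem casimir_of_isTypeTwoZero {a : Fin 3 → ℝ} (ha : ∑ i, a i ^ 2 = 1)
    {C : (V →L[ℝ] ℂ) →ₗ[ℂ] (V →L[ℝ] ℂ) →ₗ[ℂ] ℂ} (hC : IsTypeTwoZero (combination J a) C)
    (α β : V →L[ℝ] ℂ) : ∑ i, C (α.comp (J i)) (β.comp (J i)) = -C α β := by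
  have hC2 : ∀ α β, C α (β.comp (combination J a)) = Complex.I * C α β := by
    intro α β
    rw [← hC.1.neg, hC.2, ← hC.1.neg α β]
    ring
  have hC3 : ∀ α β, C (α.comp (combination J a)) (β.comp (combination J a)) = -C α β := by
    intro α β
    rw [hC.2, hC2, ← mul_assoc, Complex.I_mul_I, neg_one_mul]
  have ex : ∀ α : V →L[ℝ] ℂ, α.comp (combination J a) =
      (a 0 : ℂ) • α.comp (J 0) + (a 1 : ℂ) • α.comp (J 1) + (a 2 : ℂ) • α.comp (J 2) := by
    intro α
    ext v
    simp [combination_apply]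
  have e0 : ∀ α : V →L[ℝ] ℂ, (α.comp (J 0)).comp (combination J a) =
      -(a 0 : ℂ) • α + (a 1 : ℂ) • α.comp (J 2) - (a 2 : ℂ) • α.comp (J 1) := by
    intro α
    ext v
    simp [combination_apply, h.sq, h.mul, h.mul_zero_two]
    ring
  have e1 : ∀ α : V →L[ℝ] ℂ, (α.comp (J 1)).comp (combination J a) =
      -(a 1 : ℂ) • α - (a 0 : ℂ) • α.comp (J 2) + (a 2 : ℂ) • α.comp (J 0) := by
    intro α
    ext v
    simp [combination_apply, h.sq, h.mul_one_zero, h.mul_one_two]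
    ring
  have e2 : ∀ α : V →L[ℝ] ℂ, (α.comp (J 2)).comp (combination J a) =
      -(a 2 : ℂ) • α + (a 0 : ℂ) • α.comp (J 1) - (a 1 : ℂ) • α.comp (J 0) := by
    intro α
    ext v
    simp [combination_apply, h.sq, h.mul_two_one, h.mul_two_zero]
    ring
  -- Anti-invariance under `I_a` is averaged over the pairs obtained from `(α, β)` by `1, J₀, J₁,
  -- J₂`. The mixed terms cancel; with `S` the desired sum, what remains is `|a|² (C + S) = -(C +
  -- S)`, so `S = -C`.
  have k := hC3 α β
  have k0 := hC3 (α.comp (J 0)) (β.comp (J 0))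
  have k1 := hC3 (α.comp (J 1)) (β.comp (J 1))
  have k2 := hC3 (α.comp (J 2)) (β.comp (J 2))
  rw [ex, ex] at k
  rw [e0, e0] at k0
  rw [e1, e1] at k1
  rw [e2, e2] at k2
  simp only [map_add, map_sub, map_smul, LinearMap.add_apply, LinearMap.sub_apply,
    LinearMap.smul_apply, smul_eq_mul] at k k0 k1 k2
  have ha' : (a 0 : ℂ) ^ 2 + (a 1 : ℂ) ^ 2 + (a 2 : ℂ) ^ 2 = 1 := by
    rw [Fin.sum_univ_three] at ha
    exact_mod_cast ha
  rw [Fin.sum_univ_three]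
  linear_combination (1 / 2 : ℂ) * (k + k0 + k1 + k2) - (1 / 2 : ℂ) * (C α β +
    C (α.comp (J 0)) (β.comp (J 0)) + C (α.comp (J 1)) (β.comp (J 1)) +
    C (α.comp (J 2)) (β.comp (J 2))) * ha'

theorem casimir_of_mem_salamonComponent {C : (V →L[ℝ] ℂ) →ₗ[ℂ] (V →L[ℝ] ℂ) →ₗ[ℂ] ℂ}
    (hC : C ∈ salamonComponent J) (α β : V →L[ℝ] ℂ) :
    ∑ i, C (α.comp (J i)) (β.comp (J i)) = -C α β := by
  induction hC using Submodule.span_induction with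
  | mem C hC =>
    obtain ⟨a, ha, hC⟩ := hC
    exact h.casimir_of_isTypeTwoZero ha hC α β
  | zero => simp
  | add C D _ _ hC hD =>
    simp only [LinearMap.add_apply, Finset.sum_add_distrib, hC, hD]
    ring
  | smul c C _ hC =>
    simp only [LinearMap.smul_apply, ← Finset.smul_sum, hC, smul_neg]

theorem casimir_real {B : (V →L[ℝ] ℝ) →L[ℝ] V} (hB : complexify B ∈ salamonComponent J)
    (α β : V →L[ℝ] ℝ) : ∑ i, α (J i (B (β.comp (J i)))) = -α (B β) := by
  have hr : ∀ γ : V →L[ℝ] ℝ, reCovector (Complex.ofRealCLM.comp γ) = γ := by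
    intro γ; ext v; simp [reCovector]
  have := congrArg Complex.re (h.casimir_of_mem_salamonComponent hB
    (Complex.ofRealCLM.comp α) (Complex.ofRealCLM.comp β))
  have hi : ∀ γ : V →L[ℝ] ℝ, imCovector (Complex.ofRealCLM.comp γ) = 0 := by
    intro γ; ext v; simp [imCovector]
  simpa [complexify_apply, ContinuousLinearMap.comp_assoc, hr, hi] using this

variable [T2Space V] [FiniteDimensional ℝ V]

theorem sum_dualBivector_flat (f : Fin 3 → ℝ) (b : V) :
    (∑ i, f i • dualBivector (g.comp (J i))) (g b) = -∑ i, f i • J i b := by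
  simp [Fin.sum_univ_three, h.dualBivector_flat]
  abel

/-- The vectors `Jⱼ v` are mutually orthogonal, so pairing with `Jᵢ v` isolates the `i`-th
coefficient. Both uniqueness and smoothness of the coefficients are read off from this formula. -/
theorem coefficient_eq (f : Fin 3 → ℝ) (i : Fin 3) (v : V) :
    g (J i v) ((∑ i, f i • dualBivector (g.comp (J i))) (g v)) = -(f i * g v v) := by
  rw [h.sum_dualBivector_flat, map_neg, map_sum, Finset.sum_eq_single i]
  · simp [h.hermitian]
  · intro j _ hj
    simp [h.apply_basis hj.symm]
  · simp

theorem sum_dualBivector_alternating (f : Fin 3 → ℝ) (α : V →L[ℝ] ℝ) :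
    α ((∑ i, f i • dualBivector (g.comp (J i))) α) = 0 := by
  obtain ⟨b, rfl⟩ := h.exists_flat α
  rw [h.sum_dualBivector_flat]
  simp [h.apply_self']

theorem ext_flat {B B' : (V →L[ℝ] ℝ) →L[ℝ] V} (hB : ∀ b, B (g b) = B' (g b)) : B = B' := by
  ext1 α
  obtain ⟨b, rfl⟩ := h.exists_flat α
  exact hB b

/-- In real dimension 4 the real part of `Λ²E ⊗ S²H` is spanned by the `ωᵢ⁻¹`. -/
theorem exists_eq_sum_dualBivector (hd : Module.finrank ℝ V = 4) {B : (V →L[ℝ] ℝ) →L[ℝ] V}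
    (hB : ∀ α : V →L[ℝ] ℝ, α (B α) = 0) (hm : complexify B ∈ salamonComponent J) :
    ∃ f : Fin 3 → ℝ, B = ∑ i, f i • dualBivector (g.comp (J i)) := by
  obtain ⟨v, hv⟩ := h.exists_unit hd
  -- By `coefficient_eq` at a unit vector `v` these are the only possible coefficients.
  refine ⟨fun i => -g (J i v) (B (g v)), ?_⟩
  have hs : ∀ a b, g a (B (g b)) = -g b (B (g a)) := by
    intro α β
    have := hB (g (α + β))
    simp only [map_add, add_apply, hB] at this
    linarith
  have hcomp : ∀ i b, (g b).comp (J i) = -g (J i b) := by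
    intro i b; ext u; simp [h.skew]
  have cas : ∀ a b, ∑ i, g (J i a) (B (g (J i b))) = -g a (B (g b)) := by
    intro a b
    rw [← h.casimir_real hm]
    refine Finset.sum_congr rfl fun i _ => ?_
    simp [hcomp, h.skew]
  simp only [Fin.sum_univ_three] at cas
  have c0 := cas v (J 0 v)
  have c1 := cas v (J 1 v)
  have c2 := cas v (J 2 v)
  simp only [h.sq, h.mul, h.mul_one_zero, h.mul_one_two, h.mul_two_one, h.mul_zero_two,
    h.mul_two_zero, map_neg] at c0 c1 c2
  have s01 := hs (J 0 v) (J 1 v)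
  have s02 := hs (J 0 v) (J 2 v)
  have s12 := hs (J 1 v) (J 2 v)
  have t0 := hs (J 0 v) v
  have t1 := hs (J 1 v) v
  have t2 := hs (J 2 v) v
  refine h.ext_flat fun b => ?_
  have hexp := h.expansion hd hv
  refine h.flat_injective ?_
  ext u
  rw [h.symm, h.symm _ u, h.sum_dualBivector_flat]
  rw [hexp u, hexp b]
  have c01 := h.apply_basis (i := 0) (j := 1) (by decide) v
  have c02 := h.apply_basis (i := 0) (j := 2) (by decide) v
  have c12 := h.apply_basis (i := 1) (j := 2) (by decide) v
  have c10 := h.apply_basis (i := 1) (j := 0) (by decide) v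
  have c20 := h.apply_basis (i := 2) (j := 0) (by decide) v
  have c21 := h.apply_basis (i := 2) (j := 1) (by decide) v
  -- In the basis `v, J₀ v, J₁ v, J₂ v` an alternating form has six entries. The Casimir relation at
  -- `(v, Jᵢ v)` expresses the three entries among the `Jⱼ v` through the three entries that involve
  -- `v`.
  have d01 : g (J 0 v) (B (g (J 1 v))) = -g (J 2 v) (B (g v)) := by linarith
  have d02 : g (J 0 v) (B (g (J 2 v))) = g (J 1 v) (B (g v)) := by linarith
  have d12 : g (J 1 v) (B (g (J 2 v))) = -g (J 0 v) (B (g v)) := by linarith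
  have d10 : g (J 1 v) (B (g (J 0 v))) = g (J 2 v) (B (g v)) := by linarith
  have d20 : g (J 2 v) (B (g (J 0 v))) = -g (J 1 v) (B (g v)) := by linarith
  have d21 : g (J 2 v) (B (g (J 1 v))) = g (J 0 v) (B (g v)) := by linarith
  have t0' : g v (B (g (J 0 v))) = -g (J 0 v) (B (g v)) := by linarith
  have t1' : g v (B (g (J 1 v))) = -g (J 1 v) (B (g v)) := by linarith
  have t2' : g v (B (g (J 2 v))) = -g (J 2 v) (B (g v)) := by linarith
  simp only [map_add, map_smul, add_apply, smul_apply, smul_eq_mul, map_neg,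
    Fin.sum_univ_three, h.apply_self, h.apply_self', h.hermitian, hv, c01, c02, c12, c10, c20, c21,
    h.sq, h.mul, h.mul_one_zero, h.mul_one_two, h.mul_two_one, h.mul_zero_two, h.mul_two_zero,
    d01, d02, d12, d10, d20, d21, t0', t1', t2', hB]
  ring

/-- Each `ωᵢ⁻¹` is a section of `Λ²E ⊗ S²H`. -/
theorem complexify_sum_dualBivector_mem (f : Fin 3 → ℝ) :
    complexify (∑ i, f i • dualBivector (g.comp (J i))) ∈ salamonComponent J := by
  -- For `j ≠ i` the structure `Jⱼ` anticommutes with `Jᵢ`, so `ωᵢ⁻¹` is `Jⱼ`-anti-invariant and has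
  -- no (1,1)-part. It is therefore the sum of its (2,0)-parts for `Jⱼ` and `-Jⱼ`, the latter being
  -- the (0,2)-part for `Jⱼ`.
  have key : ∀ i j : Fin 3, i ≠ j →
      complexify (dualBivector (g.comp (J i))) ∈ salamonComponent J := by
    intro i j hij
    have halt : ∀ α : V →L[ℝ] ℝ, α (dualBivector (g.comp (J i)) α) = 0 := by
      intro α
      obtain ⟨b, rfl⟩ := h.exists_flat α
      simp [h.dualBivector_flat, h.apply_self']
    have anti : ∀ v, J i (J j v) = -J j (J i v) := by
      intro v
      fin_cases i <;> fin_cases j <;> first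
        | exact absurd rfl hij
        | simp [h.mul, h.mul_one_zero, h.mul_one_two, h.mul_two_one, h.mul_zero_two,
            h.mul_two_zero]
    have hcomp : ∀ b, (g b).comp (J j) = g (-J j b) := by
      intro b; ext u; simp [h.skew]
    have hr : ∀ α β : V →L[ℝ] ℝ, (α.comp (J j)) (dualBivector (g.comp (J i)) (β.comp (J j))) =
        -α (dualBivector (g.comp (J i)) β) := by
      intro α β
      obtain ⟨b, rfl⟩ := h.exists_flat β
      rw [hcomp, h.dualBivector_flat, h.dualBivector_flat]
      simp only [ContinuousLinearMap.comp_apply, map_neg, anti, h.sq, neg_neg]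
    have hc : ∀ α β : V →L[ℝ] ℂ,
        complexify (dualBivector (g.comp (J i))) (α.comp (J j)) (β.comp (J j)) =
          -complexify (dualBivector (g.comp (J i))) α β := by
      intro α β
      have r1 : ∀ α : V →L[ℝ] ℂ, reCovector (α.comp (J j)) = (reCovector α).comp (J j) :=
        fun _ => rfl
      have r2 : ∀ α : V →L[ℝ] ℂ, imCovector (α.comp (J j)) = (imCovector α).comp (J j) :=
        fun _ => rfl
      rw [complexify_apply, complexify_apply, r1, r1, r2, r2]
      apply Complex.ext <;> simp only [hr, Complex.neg_re, Complex.neg_im] <;> ring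
    have hcomb : ∀ ε : ℝ, combination J (Pi.single j ε) = ε • J j := by
      intro ε
      ext v
      fin_cases j <;> simp [combination_apply]
    have mem : ∀ ε : ℝ, ε ^ 2 = 1 →
        twoZeroPart (ε • J j) (dualBivector (g.comp (J i))) ∈ salamonComponent J := by
      intro ε hε
      refine Submodule.subset_span ⟨Pi.single j ε, ?_, ?_⟩
      · rw [Finset.sum_eq_single j]
        · simpa using hε
        · intro k _ hk
          simp [hk]
        · simp
      · rw [hcomb]
        refine isTypeTwoZero_twoZeroPart (fun v => ?_) halt
        simp only [smul_apply, map_smul, smul_smul, h.sq, ← _root_.sq, hε, one_smul]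
    have hsum : complexify (dualBivector (g.comp (J i))) =
        twoZeroPart ((1 : ℝ) • J j) (dualBivector (g.comp (J i))) +
          twoZeroPart ((-1 : ℝ) • J j) (dualBivector (g.comp (J i))) := by
      ext α β
      have o1 : ∀ α : V →L[ℝ] ℂ, oneZeroPart ((1 : ℝ) • J j) α =
          (1 / 2 : ℂ) • α - (1 / 2 * Complex.I) • α.comp (J j) := by
        intro α; ext v; simp [oneZeroPart_apply]; ring
      have o2 : ∀ α : V →L[ℝ] ℂ, oneZeroPart ((-1 : ℝ) • J j) α =
          (1 / 2 : ℂ) • α + (1 / 2 * Complex.I) • α.comp (J j) := by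
        intro α; ext v; simp [oneZeroPart_apply]; ring
      rw [LinearMap.add_apply, LinearMap.add_apply, twoZeroPart_apply, twoZeroPart_apply, o1, o1,
        o2, o2]
      simp only [map_add, map_sub, map_smul, LinearMap.add_apply, LinearMap.sub_apply,
        LinearMap.smul_apply, smul_eq_mul, hc]
      linear_combination (1 / 2 * complexify (dualBivector (g.comp (J i))) α β) * Complex.I_sq
    rw [hsum]
    exact Submodule.add_mem _ (mem 1 (by norm_num)) (mem (-1) (by norm_num))
  rw [Fin.sum_univ_three, complexify_add, complexify_add, complexify_smul, complexify_smul,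
    complexify_smul]
  exact Submodule.add_mem _ (Submodule.add_mem _
    (Submodule.smul_mem _ _ (key 0 1 (by decide))) (Submodule.smul_mem _ _ (key 1 2 (by decide))))
    (Submodule.smul_mem _ _ (key 2 0 (by decide)))

end IsHyperhermitian

end LinearAlgebra

/-! ### The holomorphic symplectic form of a hyperhermitian vector space -/

section LinearAlgebra

set_option linter.unusedSectionVars false

variable {V : Type*} [AddCommGroup V] [Module ℝ V] [TopologicalSpace V]
  [IsTopologicalAddGroup V] [ContinuousSMul ℝ V]

/-- The form `ω₁ + i ω₂`, which is of type `(2,0)` with respect to `J₀`. -/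
def holomorphicForm (g : V →L[ℝ] V →L[ℝ] ℝ) (J : Fin 3 → V →L[ℝ] V) (u v : V) : ℂ :=
  (g (J 1 u) v : ℂ) + Complex.I * (g (J 2 u) v : ℂ)

/-- The `ℂ`-bilinear extension of `ω₁⁻¹` to complex covectors. -/
def holomorphicPairing (g : V →L[ℝ] V →L[ℝ] ℝ) (J : Fin 3 → V →L[ℝ] V) (α β : V →L[ℝ] ℂ) : ℂ :=
  complexify (dualBivector (g.comp (J 1))) α β

namespace IsHyperhermitian

variable {g : V →L[ℝ] V →L[ℝ] ℝ} {J : Fin 3 → V →L[ℝ] V} (h : IsHyperhermitian g J)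

include h

theorem holomorphicForm_apply_zero (u v : V) :
    holomorphicForm g J (J 0 u) v = Complex.I * holomorphicForm g J u v := by
  simp only [holomorphicForm, h.mul_one_zero, h.mul_two_zero, map_neg, neg_apply,
    Complex.ofReal_neg]
  linear_combination (-(g (J 2 u) v : ℂ)) * Complex.I_sq

theorem holomorphicForm_swap (u v : V) :
    holomorphicForm g J u v = -holomorphicForm g J v u := by
  simp only [holomorphicForm, h.skew _ u v, h.symm u, Complex.ofReal_neg]
  ring

theorem holomorphicForm_apply_zero_right (u v : V) :
    holomorphicForm g J u (J 0 v) = Complex.I * holomorphicForm g J u v := by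
  rw [h.holomorphicForm_swap, h.holomorphicForm_apply_zero, h.holomorphicForm_swap u v]
  ring

theorem holomorphicForm_self (u : V) : holomorphicForm g J u u = 0 := by
  simp [holomorphicForm, h.apply_self]

/-- This positive value is the form in which nondegeneracy of `ω₁ + i ω₂` is used later. -/
theorem holomorphicForm_apply_one (u : V) : holomorphicForm g J u (J 1 u) = g u u := by
  simp [holomorphicForm, h.hermitian, h.apply_basis (i := 2) (j := 1) (by decide)]

/-- In complex dimension 2, `η ∧ ω = 0` kills the (0,1)-part of `η`. Evaluation on `u, J₀ u, J₁ u`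
leaves `(i η(u) - η(J₀ u)) g(u, u) = 0`. This is how holomorphy is detected without coordinates. -/
theorem oneZero_of_wedge_eq_zero {η : V →L[ℝ] ℂ}
    (hη : ∀ u v w, η u * holomorphicForm g J v w + η v * holomorphicForm g J w u
      + η w * holomorphicForm g J u v = 0) (u : V) : η (J 0 u) = Complex.I * η u := by
  by_cases hu : u = 0
  · simp [hu]
  have k := hη u (J 0 u) (J 1 u)
  rw [h.holomorphicForm_apply_zero, h.holomorphicForm_apply_zero_right, h.holomorphicForm_self,
    h.holomorphicForm_swap (J 1 u), h.holomorphicForm_apply_one] at k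
  have hp : (g u u : ℂ) ≠ 0 := by exact_mod_cast (h.pos u hu).ne'
  refine mul_right_cancel₀ hp ?_
  linear_combination -k

variable [T2Space V] [FiniteDimensional ℝ V]

theorem isAlt_dualBivector (i : Fin 3) : (complexify (dualBivector (g.comp (J i)))).IsAlt := by
  refine isAlt_complexify fun α => ?_
  obtain ⟨b, rfl⟩ := h.exists_flat α
  simp [h.dualBivector_flat, h.apply_self']

theorem holomorphicPairing_swap (α β : V →L[ℝ] ℂ) :
    holomorphicPairing g J α β = -holomorphicPairing g J β α := by
  rw [holomorphicPairing, holomorphicPairing, (h.isAlt_dualBivector 1).neg]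

/-- For covectors of type `(1,0)` with respect to `J₀`, the `(2,0)`-part of
`f₀ ω₀⁻¹ + f₁ ω₁⁻¹ + f₂ ω₂⁻¹` is `(f₁ + i f₂) ω₁⁻¹`. -/
theorem twoZeroPart_sum_dualBivector (f : Fin 3 → ℝ) {α β : V →L[ℝ] ℂ}
    (hα : ∀ v, α (J 0 v) = Complex.I * α v) (hβ : ∀ v, β (J 0 v) = Complex.I * β v) :
    twoZeroPart (J 0) (∑ i, f i • dualBivector (g.comp (J i))) α β =
      ((f 1 : ℂ) + Complex.I * (f 2 : ℂ)) * holomorphicPairing g J α β := by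
  rw [twoZeroPart_apply, oneZeroPart_of_oneZero hα, oneZeroPart_of_oneZero hβ]
  obtain ⟨b, hb⟩ := h.exists_flat (reCovector β)
  obtain ⟨c, hc⟩ := h.exists_flat (imCovector β)
  have hval : ∀ i, complexify (dualBivector (g.comp (J i))) α β =
      -(α (J i b) + Complex.I * α (J i c)) := by
    intro i
    rw [complexify_apply, ← hb, ← hc, h.dualBivector_flat, h.dualBivector_flat]
    apply Complex.ext
    · simp [reCovector, imCovector]
      ring
    · simp [reCovector, imCovector]
  -- The imaginary part of a (1,0)-covector is determined by its real part. With `c = J₀ b` and `α`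
  -- of type (1,0), the `ω₀⁻¹` term cancels and the `ω₂⁻¹` term becomes `i` times the `ω₁⁻¹` term.
  have hcb : c = J 0 b := by
    apply h.flat_injective
    ext u
    have := congrArg Complex.re (hβ u)
    have h1 : g b (J 0 u) = (β (J 0 u)).re := by rw [hb]; rfl
    have h2 : g c u = (β u).im := by rw [hc]; rfl
    rw [h.skew, h1, h2, this]
    simp
  rw [Fin.sum_univ_three, complexify_add, complexify_add, complexify_smul, complexify_smul,
    complexify_smul, holomorphicPairing]
  simp only [LinearMap.add_apply, LinearMap.smul_apply, smul_eq_mul, hval, hcb, h.sq,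
    h.mul_one_zero, h.mul_two_zero, map_neg, hα]
  rw [← h.mul, hα]
  linear_combination (-(f 2 : ℂ) * Complex.I * α (J 1 b)) * Complex.I_sq

/-! ### Covectors of type (1,0) in real dimension 4. -/

section FourDimensional

variable (hd : Module.finrank ℝ V = 4)

include hd

/-- A (1,0)-covector is determined by its values on `v` and `J₁ v`, which form a complex basis for
`J₀`; the two brackets are the dual basis. -/
theorem oneZero_expansion {α : V →L[ℝ] ℂ} (hα : ∀ v, α (J 0 v) = Complex.I * α v) {v : V}
    (hv : g v v = 1) (u : V) :
    α u = α v * ((g v u : ℂ) + Complex.I * (g (J 0 v) u : ℂ)) +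
      α (J 1 v) * ((g (J 1 v) u : ℂ) + Complex.I * (g (J 2 v) u : ℂ)) := by
  have h2 : α (J 2 v) = Complex.I * α (J 1 v) := by rw [← h.mul, hα]
  have := congrArg α (h.expansion hd hv u)
  rw [this]
  simp only [map_add, map_smul, hα, h2, Complex.real_smul]
  ring

/-- The (1,0)-covectors form a complex plane with basis `z, y`, so an alternating pairing is a
multiple of the determinant. The factor 2 is `ω₁⁻¹(z, y)`, to which the real parts and the imaginary
parts contribute 1 each. -/
theorem holomorphicPairing_eq {α β : V →L[ℝ] ℂ} (hα : ∀ v, α (J 0 v) = Complex.I * α v)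
    (hβ : ∀ v, β (J 0 v) = Complex.I * β v) {v : V} (hv : g v v = 1) :
    holomorphicPairing g J α β = 2 * (α v * β (J 1 v) - α (J 1 v) * β v) := by
  let z : V →L[ℝ] ℂ := Complex.ofRealCLM.comp (g v) +
    Complex.I • Complex.ofRealCLM.comp (g (J 0 v))
  let y : V →L[ℝ] ℂ := Complex.ofRealCLM.comp (g (J 1 v)) +
    Complex.I • Complex.ofRealCLM.comp (g (J 2 v))
  have hex : ∀ {α : V →L[ℝ] ℂ}, (∀ v, α (J 0 v) = Complex.I * α v) →
      α = α v • z + α (J 1 v) • y := by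
    intro α hα
    ext u
    rw [h.oneZero_expansion hd hα hv u]
    simp [z, y]
    ring
  have zre : reCovector z = g v := by ext u; simp [z, reCovector]
  have zim : imCovector z = g (J 0 v) := by ext u; simp [z, imCovector]
  have yre : reCovector y = g (J 1 v) := by ext u; simp [y, reCovector]
  have yim : imCovector y = g (J 2 v) := by ext u; simp [y, imCovector]
  have hzy : complexify (dualBivector (g.comp (J 1))) z y = 2 := by
    rw [complexify_apply, zre, zim, yre, yim, h.dualBivector_flat, h.dualBivector_flat]
    apply Complex.ext
    · simp [h.sq, h.mul_one_two, h.hermitian, hv]; norm_num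
    · simp [h.sq, h.mul_one_two, h.apply_self', h.apply_self]
  have hyz : complexify (dualBivector (g.comp (J 1))) y z = -2 := by
    rw [← (h.isAlt_dualBivector 1).neg, hzy]
  have hzz := h.isAlt_dualBivector 1 z
  have hyy := h.isAlt_dualBivector 1 y
  rw [holomorphicPairing]
  conv_lhs => rw [hex hα, hex hβ]
  simp only [map_add, map_smul, LinearMap.add_apply, LinearMap.smul_apply, smul_eq_mul, hzy, hyz,
    hzz, hyy]
  ring

/-- In real dimension 4 any 2-form of type `(2,0)` is a multiple of the holomorphic form. -/
theorem wedge_eq {α β : V →L[ℝ] ℂ} (hα : ∀ v, α (J 0 v) = Complex.I * α v)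
    (hβ : ∀ v, β (J 0 v) = Complex.I * β v) (u v : V) :
    α u * β v - α v * β u = 1 / 2 * holomorphicPairing g J α β * holomorphicForm g J u v := by
  obtain ⟨e, he⟩ := h.exists_unit hd
  -- This is `ω = z ∧ y` in the (1,0)-basis dual to `e, J₁ e`; the factor `1 / 2` in the claim
  -- compensates the 2 of `holomorphicPairing_eq`.
  have hform : ∀ u v, holomorphicForm g J u v =
      ((g e u : ℂ) + Complex.I * (g (J 0 e) u : ℂ)) *
        ((g (J 1 e) v : ℂ) + Complex.I * (g (J 2 e) v : ℂ)) -
      ((g (J 1 e) u : ℂ) + Complex.I * (g (J 2 e) u : ℂ)) *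
        ((g e v : ℂ) + Complex.I * (g (J 0 e) v : ℂ)) := by
    intro u v
    let F (u : V) : V →L[ℝ] ℂ := Complex.ofRealCLM.comp (g (J 1 u)) +
      Complex.I • Complex.ofRealCLM.comp (g (J 2 u))
    have hF : ∀ u v, F u v = holomorphicForm g J u v := fun u v => by simp [F, holomorphicForm]
    have k : ∀ u w, F u (J 0 w) = Complex.I * F u w := fun u w => by
      rw [hF, hF, h.holomorphicForm_apply_zero_right]
    have k1 := h.oneZero_expansion hd (k u) he v
    have k2 := h.oneZero_expansion hd (k e) he u
    have k3 := h.oneZero_expansion hd (k (J 1 e)) he u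
    rw [hF, hF, hF, h.holomorphicForm_swap u e, h.holomorphicForm_swap u (J 1 e)] at k1
    rw [hF, hF, hF, h.holomorphicForm_self, h.holomorphicForm_apply_one, he] at k2
    rw [hF, hF, hF, h.holomorphicForm_self, h.holomorphicForm_swap _ e,
      h.holomorphicForm_apply_one, he] at k3
    rw [k1, k2, k3]
    push_cast
    ring
  rw [h.holomorphicPairing_eq hd hα hβ he, hform, h.oneZero_expansion hd hα he u,
    h.oneZero_expansion hd hα he v, h.oneZero_expansion hd hβ he u, h.oneZero_expansion hd hβ he v]
  ring

/-- Cramer's rule: three vectors of a complex plane satisfy the linear relation whose coefficients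
are their `2 × 2` determinants. -/
theorem holomorphicPairing_cyclic {α β γ : V →L[ℝ] ℂ} (hα : ∀ v, α (J 0 v) = Complex.I * α v)
    (hβ : ∀ v, β (J 0 v) = Complex.I * β v) (hγ : ∀ v, γ (J 0 v) = Complex.I * γ v) (u : V) :
    holomorphicPairing g J α β * γ u + holomorphicPairing g J β γ * α u
      + holomorphicPairing g J γ α * β u = 0 := by
  obtain ⟨e, he⟩ := h.exists_unit hd
  rw [h.holomorphicPairing_eq hd hα hβ he, h.holomorphicPairing_eq hd hβ hγ he,
    h.holomorphicPairing_eq hd hγ hα he, h.oneZero_expansion hd hα he u,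
    h.oneZero_expansion hd hβ he u, h.oneZero_expansion hd hγ he u]
  ring

end FourDimensional

/-- In real dimension 4, a family of `(1,0)`-covectors without common zero contains two
that pair nontrivially. -/
theorem exists_holomorphicPairing_ne_zero (hd : Module.finrank ℝ V = 4) {ι : Type*}
    {α : ι → V →L[ℝ] ℂ} (hα : ∀ i v, α i (J 0 v) = Complex.I * α i v)
    (hinj : ∀ v, (∀ i, α i v = 0) → v = 0) :
    ∃ i j, holomorphicPairing g J (α i) (α j) ≠ 0 := by
  by_contra! hc
  -- If all pairings vanish, all wedge products vanish, so every covector is proportional to one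
  -- nonzero `α i`. As a real map from dimension 4 to dimension 2, that one has a nonzero kernel
  -- vector, which is a common zero.
  have hw : ∀ i j u v, α i u * α j v = α i v * α j u := by
    intro i j u v
    have := h.wedge_eq hd (hα i) (hα j) u v
    rw [hc i j] at this
    linear_combination this
  obtain ⟨e, he⟩ := h.exists_unit hd
  have he0 : e ≠ 0 := by rintro rfl; simp at he
  obtain ⟨i, hi⟩ : ∃ i, α i e ≠ 0 := by
    by_contra! hall
    exact he0 (hinj e hall)
  obtain ⟨v, hv, hv0⟩ : ∃ v, α i v = 0 ∧ v ≠ 0 := by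
    have hlt : Module.finrank ℝ ℂ < Module.finrank ℝ V := by
      rw [hd, Complex.finrank_real_complex]; norm_num
    have := LinearMap.ker_ne_bot_of_finrank_lt (f := (α i).toLinearMap) hlt
    obtain ⟨v, hv, hv0⟩ := Submodule.exists_mem_ne_zero_of_ne_bot this
    exact ⟨v, hv, hv0⟩
  refine hv0 (hinj v fun j => ?_)
  have := hw i j e v
  rw [hv, zero_mul] at this
  exact (mul_eq_zero.1 this).resolve_left hi

end IsHyperhermitian

end LinearAlgebra

/-! ### Derivatives of vector-valued functions on a manifold -/

section Derivatives

variable {E : Type*} [NormedAddCommGroup E] [NormedSpace ℝ E]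
  {M : Type*} [TopologicalSpace M] [ChartedSpace E M]
  {F F' : Type*} [NormedAddCommGroup F] [NormedSpace ℝ F] [NormedAddCommGroup F'] [NormedSpace ℝ F']

theorem mvfderiv_apply (f : M → F) (x : M) (v : TangentSpace 𝓘(ℝ, E) x) :
    mvfderiv 𝓘(ℝ, E) f x v = mfderiv 𝓘(ℝ, E) 𝓘(ℝ, F) f x v := rfl

theorem mvfderiv_congr {f f' : M → F} {x : M} (h : f =ᶠ[𝓝 x] f') :
    mvfderiv 𝓘(ℝ, E) f x = mvfderiv 𝓘(ℝ, E) f' x := by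
  ext v
  rw [mvfderiv_apply, mvfderiv_apply, h.mfderiv_eq]
  rfl

theorem mvfderiv_comp_normed {f : M → F} {G : F → F'} {x : M}
    (hG : DifferentiableAt ℝ G (f x)) (hf : MDifferentiableAt 𝓘(ℝ, E) 𝓘(ℝ, F) f x)
    (v : TangentSpace 𝓘(ℝ, E) x) :
    mvfderiv 𝓘(ℝ, E) (fun y => G (f y)) x v = fderiv ℝ G (f x) (mvfderiv 𝓘(ℝ, E) f x v) := by
  have := mfderiv_comp_apply x hG.mdifferentiableAt hf v
  rw [mfderiv_eq_fderiv] at this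
  exact this

theorem mvfderiv_clm_comp {f : M → F} (L : F →L[ℝ] F') {x : M}
    (hf : MDifferentiableAt 𝓘(ℝ, E) 𝓘(ℝ, F) f x) (v : TangentSpace 𝓘(ℝ, E) x) :
    mvfderiv 𝓘(ℝ, E) (fun y => L (f y)) x v = L (mvfderiv 𝓘(ℝ, E) f x v) := by
  rw [mvfderiv_comp_normed L.differentiableAt hf, L.fderiv]

theorem mvfderiv_mul_complex {f f' : M → ℂ} {x : M} (hf : MDifferentiableAt 𝓘(ℝ, E) 𝓘(ℝ, ℂ) f x)
    (hf' : MDifferentiableAt 𝓘(ℝ, E) 𝓘(ℝ, ℂ) f' x) (v : TangentSpace 𝓘(ℝ, E) x) :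
    mvfderiv 𝓘(ℝ, E) (fun y => f y * f' y) x v =
      f x * mvfderiv 𝓘(ℝ, E) f' x v + f' x * mvfderiv 𝓘(ℝ, E) f x v := by
  have h := (hf.hasMFDerivAt.mul hf'.hasMFDerivAt).mfderiv
  have h' := congrArg (fun T => T v) h
  exact h'.trans (by simp; rfl)

end Derivatives

/-! ### Vector fields that are constant in a chart, and calculus with them. -/

section Coordinates

variable {E : Type*} [NormedAddCommGroup E] [NormedSpace ℝ E] [CompleteSpace E]
  {M : Type*} [TopologicalSpace M] [ChartedSpace E M] [IsManifold 𝓘(ℝ, E) ∞ M]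
  {F : Type*} [NormedAddCommGroup F] [NormedSpace ℝ F]

set_option linter.unusedSectionVars false

/-- The constant vector field on a normed space. -/
def constField (v : E) : ∀ x : E, TangentSpace 𝓘(ℝ, E) x := fun _ => v

/-- The vector field on a chart domain that is constant in that chart. -/
def coordField (p : M) (v : E) : ∀ x : M, TangentSpace 𝓘(ℝ, E) x :=
  VectorField.mpullback 𝓘(ℝ, E) 𝓘(ℝ, E) (extChartAt 𝓘(ℝ, E) p) (constField v)

theorem two_le_infty : (2 : WithTop ℕ∞) ≤ ∞ := 
  WithTop.coe_le_coe.2 (le_top : (2 : ℕ∞) ≤ ⊤)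

theorem isManifold_one : IsManifold 𝓘(ℝ, E) 1 M := IsManifold.of_le (n := ∞) (by simp)

theorem mfderiv_coordField {p x : M} (hx : x ∈ (chartAt E p).source) (v : E) :
    mfderiv 𝓘(ℝ, E) 𝓘(ℝ, E) (extChartAt 𝓘(ℝ, E) p) x (coordField p v x) = v := by
  have := isManifold_one (E := E) (M := M)
  have hi : (mfderiv 𝓘(ℝ, E) 𝓘(ℝ, E) (extChartAt 𝓘(ℝ, E) p) x).IsInvertible :=
    isInvertible_mfderiv_extChartAt (by simpa using hx)
  obtain ⟨e, he⟩ := hi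
  rw [coordField, VectorField.mpullback_apply, ← he, ContinuousLinearMap.inverse_equiv]
  exact e.apply_symm_apply _

theorem exists_coordField_ne_zero (hE : 0 < Module.finrank ℝ E) (p : M) :
    ∃ v : E, ∀ x ∈ (chartAt E p).source, (coordField p v x : TangentSpace 𝓘(ℝ, E) x) ≠ 0 := by
  have : Nontrivial E := Module.nontrivial_of_finrank_pos (R := ℝ) hE
  obtain ⟨v, hv⟩ := exists_ne (0 : E)
  refine ⟨v, fun x hx h0 => hv ?_⟩
  rw [← mfderiv_coordField hx v, h0, map_zero]
  rfl

theorem exists_coordField_eq (p : M) (u : TangentSpace 𝓘(ℝ, E) p) :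
    ∃ v : E, coordField p v p = u := by
  have := isManifold_one (E := E) (M := M)
  have hi : (mfderiv 𝓘(ℝ, E) 𝓘(ℝ, E) (extChartAt 𝓘(ℝ, E) p) p).IsInvertible :=
    isInvertible_mfderiv_extChartAt (by simp)
  obtain ⟨e, he⟩ := hi
  refine ⟨e u, ?_⟩
  change VectorField.mpullback 𝓘(ℝ, E) 𝓘(ℝ, E) (extChartAt 𝓘(ℝ, E) p) (constField (e u)) p = u
  rw [VectorField.mpullback_apply, ← he, ContinuousLinearMap.inverse_equiv]
  exact e.symm_apply_apply _

theorem contMDiffAt_coordField {p x : M} (hx : x ∈ (chartAt E p).source) (v : E) :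
    ContMDiffAt 𝓘(ℝ, E) (𝓘(ℝ, E).prod 𝓘(ℝ, E)) ∞
      (fun x => (Bundle.TotalSpace.mk' E x (coordField p v x) : TangentBundle 𝓘(ℝ, E) M)) x := by
  have := isManifold_one (E := E) (M := M)
  refine ContMDiffAt.mpullback_vectorField_preimage (n := ∞) ?_ (contMDiffAt_extChartAt' hx)
    (isInvertible_mfderiv_extChartAt (by simpa using hx)) (by simp)
  exact contMDiffAt_vectorSpace_iff_contDiffAt.2 contDiffAt_const

theorem isSmoothVectorFieldOn_coordField (p : M) (v : E) :
    IsSmoothVectorFieldOn (chartAt E p).source (coordField p v : ∀ x : M, TangentSpace 𝓘(ℝ, E) x) :=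
  fun _ hx => (contMDiffAt_coordField hx v).contMDiffWithinAt

/-- Brackets commute with pullback and constant fields commute. Cartan's formula for `dw` thus loses
its bracket terms on these fields. -/
theorem mlieBracket_coordField {p x : M} (hx : x ∈ (chartAt E p).source) (v w : E) :
    VectorField.mlieBracket 𝓘(ℝ, E) (coordField p v) (coordField p w) x = 0 := by
  have := isManifold_one (E := E) (M := M)
  have hc : ∀ v : E, MDifferentiableAt 𝓘(ℝ, E) (𝓘(ℝ, E).prod 𝓘(ℝ, E))
      (fun x : E => (Bundle.TotalSpace.mk' E x (constField v x) : TangentBundle 𝓘(ℝ, E) E))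
      (extChartAt 𝓘(ℝ, E) p x) := by
    intro v
    refine ContMDiffAt.mdifferentiableAt (n := 1) ?_ one_ne_zero
    exact contMDiffAt_vectorSpace_iff_contDiffAt.2 contDiffAt_const
  have htwo : IsManifold 𝓘(ℝ, E) (minSmoothness ℝ 2) M :=
    IsManifold.of_le (n := ∞) (by simpa using two_le_infty)
  have h0 : VectorField.mlieBracket 𝓘(ℝ, E) (constField v) (constField w) = 0 := by
    rw [← VectorField.mlieBracketWithin_univ, VectorField.mlieBracketWithin_eq_lieBracketWithin]
    funext y
    change fderivWithin ℝ (fun _ : E => w) Set.univ y v -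
      fderivWithin ℝ (fun _ : E => v) Set.univ y w = (0 : E)
    simp
  have := VectorField.mpullback_mlieBracket (I := 𝓘(ℝ, E)) (hc v) (hc w)
    (contMDiffAt_extChartAt' (n := ∞) hx) (by simpa using two_le_infty)
  rw [coordField, coordField, ← this, h0, VectorField.mpullback_zero]
  rfl

theorem mvfderiv_coordField {f : M → F} {p x : M} (hx : x ∈ (chartAt E p).source)
    (hf : MDifferentiableAt 𝓘(ℝ, E) 𝓘(ℝ, F) f x) (v : E) :
    mvfderiv 𝓘(ℝ, E) f x (coordField p v x) =
      fderiv ℝ (fun z => f ((extChartAt 𝓘(ℝ, E) p).symm z)) (extChartAt 𝓘(ℝ, E) p x) v := by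
  have hx' : x ∈ (extChartAt 𝓘(ℝ, E) p).source := by simpa using hx
  have hone := isManifold_one (E := E) (M := M)
  have hsymm : MDifferentiableAt 𝓘(ℝ, E) 𝓘(ℝ, E) (extChartAt 𝓘(ℝ, E) p).symm
      (extChartAt 𝓘(ℝ, E) p x) :=
    ((contMDiffOn_extChartAt_symm (n := 1) p).contMDiffAt
      ((isOpen_extChartAt_target p).mem_nhds ((extChartAt 𝓘(ℝ, E) p).map_source hx'))
      ).mdifferentiableAt one_ne_zero
  have hG : MDifferentiableAt 𝓘(ℝ, E) 𝓘(ℝ, F) (fun z => f ((extChartAt 𝓘(ℝ, E) p).symm z))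
      (extChartAt 𝓘(ℝ, E) p x) := by
    refine MDifferentiableAt.comp (I' := 𝓘(ℝ, E)) _ (g := f) ?_ hsymm
    rwa [(extChartAt 𝓘(ℝ, E) p).left_inv hx']
  have hφ : MDifferentiableAt 𝓘(ℝ, E) 𝓘(ℝ, E) (extChartAt 𝓘(ℝ, E) p) x :=
    (contMDiffAt_extChartAt' (n := 1) hx).mdifferentiableAt one_ne_zero
  have heq : f =ᶠ[𝓝 x] fun y => (fun z => f ((extChartAt 𝓘(ℝ, E) p).symm z))
      (extChartAt 𝓘(ℝ, E) p y) := by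
    filter_upwards [(isOpen_extChartAt_source (I := 𝓘(ℝ, E)) p).mem_nhds hx'] with y hy
    simp only [(extChartAt 𝓘(ℝ, E) p).left_inv hy]
  rw [mvfderiv_congr heq, mvfderiv_comp_normed hG.differentiableAt hφ, mvfderiv_apply,
    mfderiv_coordField hx]

theorem contDiffAt_comp_extChartAt_symm {f : M → F} {p : M}
    (hf : ContMDiffAt 𝓘(ℝ, E) 𝓘(ℝ, F) ∞ f p) :
    ContDiffAt ℝ ∞ (fun z => f ((extChartAt 𝓘(ℝ, E) p).symm z)) (extChartAt 𝓘(ℝ, E) p p) := by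
  refine ContMDiffAt.contDiffAt ?_
  refine ContMDiffAt.comp (I' := 𝓘(ℝ, E)) (g := f) _ (by simpa using hf) ?_
  exact (contMDiffOn_extChartAt_symm p).contMDiffAt
    ((isOpen_extChartAt_target p).mem_nhds (mem_extChartAt_target p))

theorem eventually_mdifferentiableAt {f : M → F} {p : M}
    (hf : ContMDiffAt 𝓘(ℝ, E) 𝓘(ℝ, F) ∞ f p) :
    ∀ᶠ x in 𝓝 p, MDifferentiableAt 𝓘(ℝ, E) 𝓘(ℝ, F) f x := by
  have hone := isManifold_one (E := E) (M := M)
  have h1 : ContMDiffAt 𝓘(ℝ, E) 𝓘(ℝ, F) 1 f p := hf.of_le (by simp)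
  filter_upwards [(contMDiffAt_iff_contMDiffAt_nhds (by norm_num)).1 h1] with x hx
  exact hx.mdifferentiableAt one_ne_zero

/-- Second derivatives along coordinate vector fields commute. -/
theorem mvfderiv_coordField_comm {f : M → F} {p : M} (hf : ContMDiffAt 𝓘(ℝ, E) 𝓘(ℝ, F) ∞ f p)
    (v w : E) :
    mvfderiv 𝓘(ℝ, E) (fun x => mvfderiv 𝓘(ℝ, E) f x (coordField p v x)) p (coordField p w p) =
      mvfderiv 𝓘(ℝ, E) (fun x => mvfderiv 𝓘(ℝ, E) f x (coordField p w x)) p (coordField p v p) := by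
  have hG := contDiffAt_comp_extChartAt_symm hf
  set G := fun z => f ((extChartAt 𝓘(ℝ, E) p).symm z) with hGdef
  have hG1 : DifferentiableAt ℝ (fderiv ℝ G) (extChartAt 𝓘(ℝ, E) p p) :=
    (hG.fderiv_right (m := 1) (by rw [one_add_one_eq_two]; exact two_le_infty)).differentiableAt one_ne_zero
  have hone := isManifold_one (E := E) (M := M)
  have hp := mem_chart_source E p
  have hφ : MDifferentiableAt 𝓘(ℝ, E) 𝓘(ℝ, E) (extChartAt 𝓘(ℝ, E) p) p :=
    (contMDiffAt_extChartAt' (n := 1) hp).mdifferentiableAt one_ne_zero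
  have key : ∀ v w : E, mvfderiv 𝓘(ℝ, E) (fun x => mvfderiv 𝓘(ℝ, E) f x (coordField p v x)) p
      (coordField p w p) = fderiv ℝ (fderiv ℝ G) (extChartAt 𝓘(ℝ, E) p p) w v := by
    intro v w
    have heq : (fun x => mvfderiv 𝓘(ℝ, E) f x (coordField p v x)) =ᶠ[𝓝 p]
        fun x => (fun z => fderiv ℝ G z v) (extChartAt 𝓘(ℝ, E) p x) := by
      filter_upwards [eventually_mdifferentiableAt hf, (chartAt E p).open_source.mem_nhds hp]
        with x hx hx'
      rw [mvfderiv_coordField hx' hx]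
    rw [mvfderiv_congr heq, mvfderiv_comp_normed (hG1.clm_apply (differentiableAt_const _)) hφ,
      mvfderiv_apply, mfderiv_coordField hp, fderiv_clm_apply hG1 (differentiableAt_const _)]
    simp
  rw [key, key]
  exact hG.isSymmSndFDerivAt (by simpa using two_le_infty) w v

theorem contMDiffAt_mvfderiv_apply {f : M → F} {p : M} (hf : ContMDiffAt 𝓘(ℝ, E) 𝓘(ℝ, F) ∞ f p)
    {X : ∀ x : M, TangentSpace 𝓘(ℝ, E) x}
    (hX : ContMDiffAt 𝓘(ℝ, E) (𝓘(ℝ, E).prod 𝓘(ℝ, E)) ∞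
      (fun x => (Bundle.TotalSpace.mk' E x (X x) : TangentBundle 𝓘(ℝ, E) M)) p) :
    ContMDiffAt 𝓘(ℝ, E) 𝓘(ℝ, F) ∞ (fun x => mvfderiv 𝓘(ℝ, E) f x (X x)) p := by
  have hone := isManifold_one (E := E) (M := M)
  have h1 := hf.mfderiv_const (m := ∞) (by simp)
  have h2 := ContMDiffAt.clm_apply_of_inCoordinates (b₁ := id) (b₂ := f) (v := X) h1 hX hf
  exact (contMDiff_snd_tangentBundle_modelSpace F 𝓘(ℝ, F)).contMDiffAt.comp p h2

/-- A function with vanishing derivative on a connected manifold is constant. -/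
theorem exists_eq_const_of_mvfderiv_eq_zero [ConnectedSpace M] {f : M → F}
    (hf : ContMDiff 𝓘(ℝ, E) 𝓘(ℝ, F) ∞ f) (h0 : ∀ x, mvfderiv 𝓘(ℝ, E) f x = 0) :
    ∃ c, ∀ x, f x = c := by
  have hone := isManifold_one (E := E) (M := M)
  have hloc : IsLocallyConstant f := by
    rw [IsLocallyConstant.iff_eventually_eq]
    intro p
    obtain ⟨r, hr, hball⟩ := Metric.isOpen_iff.1 (isOpen_extChartAt_target (I := 𝓘(ℝ, E)) p) _
      (mem_extChartAt_target p)
    have hd : ∀ z ∈ Metric.ball (extChartAt 𝓘(ℝ, E) p p) r,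
        MDifferentiableAt 𝓘(ℝ, E) 𝓘(ℝ, F) (fun z => f ((extChartAt 𝓘(ℝ, E) p).symm z)) z := by
      intro z hz
      refine MDifferentiableAt.comp (I' := 𝓘(ℝ, E)) _ (g := f)
        (hf.mdifferentiable (by simp) _) ?_
      exact ((contMDiffOn_extChartAt_symm (n := 1) p).contMDiffAt
        ((isOpen_extChartAt_target p).mem_nhds (hball hz))).mdifferentiableAt one_ne_zero
    have hc : ∀ z ∈ Metric.ball (extChartAt 𝓘(ℝ, E) p p) r,
        f ((extChartAt 𝓘(ℝ, E) p).symm z) = f p := by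
      intro z hz
      have := Metric.isOpen_ball.is_const_of_fderiv_eq_zero (𝕜 := ℝ)
        (convex_ball (extChartAt 𝓘(ℝ, E) p p) r).isPreconnected
        (fun z hz => (hd z hz).differentiableAt.differentiableWithinAt) ?_ hz
        (Metric.mem_ball_self hr)
      · simpa using this
      · intro z hz
        ext v
        have hs : (extChartAt 𝓘(ℝ, E) p).symm z ∈ (chartAt E p).source := by
          simpa using (extChartAt 𝓘(ℝ, E) p).map_target (hball hz)
        have := mvfderiv_coordField hs (hf.mdifferentiable (by simp) _) v
        rw [(extChartAt 𝓘(ℝ, E) p).right_inv (hball hz), h0] at this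
        exact this.symm
    filter_upwards [(continuousAt_extChartAt (I := 𝓘(ℝ, E)) p).preimage_mem_nhds
      (Metric.ball_mem_nhds _ hr), (isOpen_extChartAt_source (I := 𝓘(ℝ, E)) p).mem_nhds
      (mem_extChartAt_source p)] with x hx hx'
    have := hc _ hx
    rwa [(extChartAt 𝓘(ℝ, E) p).left_inv hx'] at this
  obtain ⟨p⟩ := (inferInstance : Nonempty M)
  exact ⟨f p, fun x => hloc.apply_eq_of_isPreconnected isPreconnected_univ trivial trivial⟩

end Coordinates

/-! ### Smooth homomorphisms of vector bundles -/

section HomBundle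

open Bundle ContinuousLinearMap

set_option linter.unusedSectionVars false

variable {B : Type*} {n : WithTop ℕ∞} {EB : Type*} [NormedAddCommGroup EB] [NormedSpace ℝ EB]
  {HB : Type*} [TopologicalSpace HB] {IB : ModelWithCorners ℝ EB HB} [TopologicalSpace B]
  [ChartedSpace HB B]
  {F₁ F₂ F₃ : Type*} {E₁ E₂ E₃ : B → Type*}
  [NormedAddCommGroup F₁] [NormedSpace ℝ F₁] [∀ x, AddCommGroup (E₁ x)] [∀ x, Module ℝ (E₁ x)]
  [TopologicalSpace (TotalSpace F₁ E₁)] [∀ x, TopologicalSpace (E₁ x)]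
  [∀ x, IsTopologicalAddGroup (E₁ x)] [∀ x, ContinuousSMul ℝ (E₁ x)]
  [FiberBundle F₁ E₁] [VectorBundle ℝ F₁ E₁]
  [NormedAddCommGroup F₂] [NormedSpace ℝ F₂] [∀ x, AddCommGroup (E₂ x)] [∀ x, Module ℝ (E₂ x)]
  [TopologicalSpace (TotalSpace F₂ E₂)] [∀ x, TopologicalSpace (E₂ x)]
  [∀ x, IsTopologicalAddGroup (E₂ x)] [∀ x, ContinuousSMul ℝ (E₂ x)]
  [FiberBundle F₂ E₂] [VectorBundle ℝ F₂ E₂]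
  [NormedAddCommGroup F₃] [NormedSpace ℝ F₃] [∀ x, AddCommGroup (E₃ x)] [∀ x, Module ℝ (E₃ x)]
  [TopologicalSpace (TotalSpace F₃ E₃)] [∀ x, TopologicalSpace (E₃ x)]
  [∀ x, IsTopologicalAddGroup (E₃ x)] [∀ x, ContinuousSMul ℝ (E₃ x)]
  [FiberBundle F₃ E₃] [VectorBundle ℝ F₃ E₃]

/-- In local trivialisations this is composition of operators; the trivialisation of the middle
bundle cancels. -/
theorem contMDiffAt_bundle_comp {ϕ : ∀ x, E₂ x →L[ℝ] E₃ x} {ψ : ∀ x, E₁ x →L[ℝ] E₂ x} {x₀ : B}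
    (hϕ : ContMDiffAt IB (IB.prod 𝓘(ℝ, F₂ →L[ℝ] F₃)) n
      (fun x => TotalSpace.mk' (F₂ →L[ℝ] F₃) (E := fun x => E₂ x →L[ℝ] E₃ x) x (ϕ x)) x₀)
    (hψ : ContMDiffAt IB (IB.prod 𝓘(ℝ, F₁ →L[ℝ] F₂)) n
      (fun x => TotalSpace.mk' (F₁ →L[ℝ] F₂) (E := fun x => E₁ x →L[ℝ] E₂ x) x (ψ x)) x₀) :
    ContMDiffAt IB (IB.prod 𝓘(ℝ, F₁ →L[ℝ] F₃)) n
      (fun x => TotalSpace.mk' (F₁ →L[ℝ] F₃) (E := fun x => E₁ x →L[ℝ] E₃ x) x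
        ((ϕ x).comp (ψ x))) x₀ := by
  rw [contMDiffAt_hom_bundle] at hϕ hψ ⊢
  refine ⟨hϕ.1, ?_⟩
  refine (hϕ.2.clm_comp hψ.2).congr_of_eventuallyEq ?_
  filter_upwards [(trivializationAt F₁ E₁ x₀).open_baseSet.mem_nhds
      (FiberBundle.mem_baseSet_trivializationAt' x₀),
    (trivializationAt F₂ E₂ x₀).open_baseSet.mem_nhds
      (FiberBundle.mem_baseSet_trivializationAt' x₀),
    (trivializationAt F₃ E₃ x₀).open_baseSet.mem_nhds
      (FiberBundle.mem_baseSet_trivializationAt' x₀)] with x h1 h2 h3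
  rw [inCoordinates_eq h1 h3, inCoordinates_eq h2 h3, inCoordinates_eq h1 h2]
  ext v
  simp only [coe_comp, Function.comp_apply, ContinuousLinearEquiv.coe_coe,
    ContinuousLinearEquiv.symm_apply_apply]

/-- Operator inversion is smooth at an invertible operator. This gives smoothness of the bivectors
`ωᵢ⁻¹`. -/
theorem contMDiffAt_bundle_inverse [CompleteSpace F₁] {ϕ : ∀ x, E₁ x →L[ℝ] E₂ x} {x₀ : B}
    (hϕ : ContMDiffAt IB (IB.prod 𝓘(ℝ, F₁ →L[ℝ] F₂)) n
      (fun x => TotalSpace.mk' (F₁ →L[ℝ] F₂) (E := fun x => E₁ x →L[ℝ] E₂ x) x (ϕ x)) x₀)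
    (hinv : (ϕ x₀).IsInvertible) :
    ContMDiffAt IB (IB.prod 𝓘(ℝ, F₂ →L[ℝ] F₁)) n
      (fun x => TotalSpace.mk' (F₂ →L[ℝ] F₁) (E := fun x => E₂ x →L[ℝ] E₁ x) x
        ((ϕ x).inverse)) x₀ := by
  rw [contMDiffAt_hom_bundle] at hϕ ⊢
  refine ⟨hϕ.1, ?_⟩
  have h0 : ContDiffAt ℝ n (ContinuousLinearMap.inverse : (F₁ →L[ℝ] F₂) → _)
      (inCoordinates F₁ E₁ F₂ E₂ x₀ x₀ x₀ x₀ (ϕ x₀)) := by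
    apply IsInvertible.contDiffAt_map_inverse
    rw [inCoordinates_eq (FiberBundle.mem_baseSet_trivializationAt' x₀)
      (FiberBundle.mem_baseSet_trivializationAt' x₀)]
    exact isInvertible_equiv.comp (hinv.comp isInvertible_equiv)
  refine (h0.contMDiffAt.comp x₀ hϕ.2).congr_of_eventuallyEq ?_
  filter_upwards [(trivializationAt F₁ E₁ x₀).open_baseSet.mem_nhds
      (FiberBundle.mem_baseSet_trivializationAt' x₀),
    (trivializationAt F₂ E₂ x₀).open_baseSet.mem_nhds
      (FiberBundle.mem_baseSet_trivializationAt' x₀)] with x h1 h2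
  simp only [Function.comp_apply]
  rw [inCoordinates_eq h1 h2, inCoordinates_eq h2 h1]
  -- `inverse` is compatible with composition by equivalences for every operator, so invertibility
  -- of `ϕ x` near `x₀` is not needed here.
  simp only [inverse_equiv_comp, inverse_comp_equiv, ContinuousLinearEquiv.symm_symm]
  rfl

end HomBundle

/-! ### Closed hyperhermitian triples -/

section ClosedTriple

set_option linter.unusedSectionVars false

variable {E : Type*} [NormedAddCommGroup E] [NormedSpace ℝ E]
  {M : Type*} [TopologicalSpace M] [ChartedSpace E M]

instance t2Space_tangentSpace (x : M) : T2Space (TangentSpace 𝓘(ℝ, E) x) :=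
  inferInstanceAs (T2Space E)

instance finiteDimensional_tangentSpace [FiniteDimensional ℝ E] (x : M) :
    FiniteDimensional ℝ (TangentSpace 𝓘(ℝ, E) x) :=
  inferInstanceAs (FiniteDimensional ℝ E)

theorem mvfderiv_add_I_mul {a b : M → ℝ} {x : M} (ha : MDifferentiableAt 𝓘(ℝ, E) 𝓘(ℝ, ℝ) a x)
    (hb : MDifferentiableAt 𝓘(ℝ, E) 𝓘(ℝ, ℝ) b x) (v : TangentSpace 𝓘(ℝ, E) x) :
    mvfderiv 𝓘(ℝ, E) (fun y => (a y : ℂ) + Complex.I * (b y : ℂ)) x v =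
      (mvfderiv 𝓘(ℝ, E) a x v : ℂ) + Complex.I * (mvfderiv 𝓘(ℝ, E) b x v : ℂ) := by
  have hab : MDifferentiableAt 𝓘(ℝ, E) 𝓘(ℝ, ℝ × ℝ) (fun y => (a y, b y)) x := ha.prodMk_space hb
  have e : (fun y => (a y : ℂ) + Complex.I * (b y : ℂ)) = fun y =>
      Complex.equivRealProdCLM.symm (a y, b y) := by
    funext y
    apply Complex.ext <;> simp
  have h1 := mvfderiv_clm_comp (ContinuousLinearMap.fst ℝ ℝ ℝ) hab v
  have h2 := mvfderiv_clm_comp (ContinuousLinearMap.snd ℝ ℝ ℝ) hab v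
  have h3 := mvfderiv_clm_comp (Complex.equivRealProdCLM.symm : ℝ × ℝ →L[ℝ] ℂ) hab v
  simp only [ContinuousLinearMap.coe_fst', ContinuousLinearMap.coe_snd'] at h1 h2
  rw [e, h1, h2]
  refine h3.trans ?_
  apply Complex.ext <;> simp

theorem contMDiffAt_add_I_mul {a b : M → ℝ} {x : M} (ha : ContMDiffAt 𝓘(ℝ, E) 𝓘(ℝ, ℝ) ∞ a x)
    (hb : ContMDiffAt 𝓘(ℝ, E) 𝓘(ℝ, ℝ) ∞ b x) :
    ContMDiffAt 𝓘(ℝ, E) 𝓘(ℝ, ℂ) ∞ (fun y => (a y : ℂ) + Complex.I * (b y : ℂ)) x := by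
  have e : (fun y => (a y : ℂ) + Complex.I * (b y : ℂ)) = fun y =>
      Complex.equivRealProdCLM.symm (a y, b y) := by
    funext y
    apply Complex.ext <;> simp
  rw [e]
  exact (Complex.equivRealProdCLM.symm.contDiff.contMDiff.contMDiffAt).comp x (ha.prodMk_space hb)

theorem contMDiffAt_mul_complex {a b : M → ℂ} {x : M} (ha : ContMDiffAt 𝓘(ℝ, E) 𝓘(ℝ, ℂ) ∞ a x)
    (hb : ContMDiffAt 𝓘(ℝ, E) 𝓘(ℝ, ℂ) ∞ b x) :
    ContMDiffAt 𝓘(ℝ, E) 𝓘(ℝ, ℂ) ∞ (fun y => a y * b y) x :=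
  ((contDiff_mul (𝕜 := ℝ) (𝔸 := ℂ)).contMDiff.contMDiffAt).comp x (ha.prodMk_space hb)

theorem mvfderiv_mul_sub_mul {a b c d : M → ℂ} {x : M}
    (ha : MDifferentiableAt 𝓘(ℝ, E) 𝓘(ℝ, ℂ) a x) (hb : MDifferentiableAt 𝓘(ℝ, E) 𝓘(ℝ, ℂ) b x)
    (hc : MDifferentiableAt 𝓘(ℝ, E) 𝓘(ℝ, ℂ) c x) (hd : MDifferentiableAt 𝓘(ℝ, E) 𝓘(ℝ, ℂ) d x)
    (v : TangentSpace 𝓘(ℝ, E) x) :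
    mvfderiv 𝓘(ℝ, E) (fun y => a y * b y - c y * d y) x v =
      (a x * mvfderiv 𝓘(ℝ, E) b x v + b x * mvfderiv 𝓘(ℝ, E) a x v) -
      (c x * mvfderiv 𝓘(ℝ, E) d x v + d x * mvfderiv 𝓘(ℝ, E) c x v) := by
  have h := mvfderiv_fun_sub (I := 𝓘(ℝ, E)) (g := fun y => a y * b y) (g' := fun y => c y * d y)
    (ha.mul hb) (hc.mul hd)
  rw [h, sub_apply, mvfderiv_mul_complex ha hb, mvfderiv_mul_complex hc hd]

variable [IsManifold 𝓘(ℝ, E) ∞ M]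

variable (E M) in
/-- A Riemannian metric with a compatible quaternionic triple of almost complex structures whose
fundamental forms are closed. -/
structure ClosedTriple where
  /-- the Riemannian metric -/
  g : Bundle.ContMDiffRiemannianMetric 𝓘(ℝ, E) ∞ E (fun x : M => TangentSpace 𝓘(ℝ, E) x)
  /-- the three almost complex structures -/
  J : Fin 3 → ∀ x : M, TangentSpace 𝓘(ℝ, E) x →L[ℝ] TangentSpace 𝓘(ℝ, E) x
  smooth_J : ∀ i, IsSmoothEndomorphism (J i)
  hyperhermitian : ∀ x, IsHyperhermitian (g.inner x) (fun i => J i x)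
  closed : ∀ i, IsClosedTwoForm (fun x => (g.inner x).comp (J i x))

/-- Smoothness at a point of a vector field. -/
abbrev SmoothFieldAt (X : ∀ x : M, TangentSpace 𝓘(ℝ, E) x) (p : M) : Prop :=
  ContMDiffAt 𝓘(ℝ, E) (𝓘(ℝ, E).prod 𝓘(ℝ, E)) ∞
    (fun x => (Bundle.TotalSpace.mk' E x (X x) : TangentBundle 𝓘(ℝ, E) M)) p

theorem contMDiffAt_metric_apply
    (g : Bundle.ContMDiffRiemannianMetric 𝓘(ℝ, E) ∞ E (fun x : M => TangentSpace 𝓘(ℝ, E) x))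
    {X Y : ∀ x : M, TangentSpace 𝓘(ℝ, E) x} {p : M} (hX : SmoothFieldAt X p)
    (hY : SmoothFieldAt Y p) :
    ContMDiffAt 𝓘(ℝ, E) 𝓘(ℝ, ℝ) ∞ (fun x => g.inner x (X x) (Y x)) p := by
  have : ContMDiffAt 𝓘(ℝ, E) (𝓘(ℝ, E).prod 𝓘(ℝ)) ∞
      (fun m => Bundle.TotalSpace.mk' ℝ (E := Bundle.Trivial M ℝ) m (g.inner m (X m) (Y m))) p := by
    apply ContMDiffAt.clm_bundle_apply₂ (F₁ := E) (F₂ := E)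
    · exact g.contMDiff.contMDiffAt
    · exact hX
    · exact hY
  simp only [Bundle.contMDiffAt_totalSpace] at this
  exact this.2

theorem IsSmoothEndomorphism.apply
    {J : ∀ x : M, TangentSpace 𝓘(ℝ, E) x →L[ℝ] TangentSpace 𝓘(ℝ, E) x}
    (hJ : IsSmoothEndomorphism J) {X : ∀ x : M, TangentSpace 𝓘(ℝ, E) x} {p : M}
    (hX : SmoothFieldAt X p) : SmoothFieldAt (fun x => J x (X x)) p :=
  ContMDiffAt.clm_bundle_apply (F₁ := E) (F₂ := E) hJ.contMDiffAt hX

namespace ClosedTriple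

variable (T : ClosedTriple E M)

/-- The closed form `ω₁ + i ω₂`. -/
def form (x : M) (u v : TangentSpace 𝓘(ℝ, E) x) : ℂ :=
  holomorphicForm (T.g.inner x) (fun i => T.J i x) u v

/-- The bracket of two functions defined by `ω₁⁻¹`. -/
def pairing (F G : M → ℂ) (x : M) : ℂ :=
  holomorphicPairing (T.g.inner x) (fun i => T.J i x)
    (mvfderiv 𝓘(ℝ, E) F x) (mvfderiv 𝓘(ℝ, E) G x)

theorem contMDiffAt_form {X Y : ∀ x : M, TangentSpace 𝓘(ℝ, E) x} {p : M}
    (hX : SmoothFieldAt X p) (hY : SmoothFieldAt Y p) :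
    ContMDiffAt 𝓘(ℝ, E) 𝓘(ℝ, ℂ) ∞ (fun x => T.form x (X x) (Y x)) p :=
  contMDiffAt_add_I_mul (contMDiffAt_metric_apply T.g ((T.smooth_J 1).apply hX) hY)
    (contMDiffAt_metric_apply T.g ((T.smooth_J 2).apply hX) hY)

variable [CompleteSpace E]

/-- The equation `dωᵢ = 0` on commuting fields. As every tangent vector at `p` extends to such a
field, nothing is lost. -/
theorem cyclic_kahlerForm (i : Fin 3) (p : M) (u v w : E) :
    mvfderiv 𝓘(ℝ, E) (fun y => T.g.inner y (T.J i y (coordField p v y)) (coordField p w y)) p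
        (coordField p u p) +
      mvfderiv 𝓘(ℝ, E) (fun y => T.g.inner y (T.J i y (coordField p w y)) (coordField p u y)) p
        (coordField p v p) +
      mvfderiv 𝓘(ℝ, E) (fun y => T.g.inner y (T.J i y (coordField p u y)) (coordField p v y)) p
        (coordField p w p) = 0 := by
  have := T.closed i (chartAt E p).source (coordField p u) (coordField p v) (coordField p w)
    (chartAt E p).open_source (isSmoothVectorFieldOn_coordField p u)
    (isSmoothVectorFieldOn_coordField p v) (isSmoothVectorFieldOn_coordField p w) p
    (mem_chart_source E p)
  rw [extDerivTwoForm, mlieBracket_coordField (mem_chart_source E p),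
    mlieBracket_coordField (mem_chart_source E p),
    mlieBracket_coordField (mem_chart_source E p)] at this
  simpa using this

theorem cyclic_form (p : M) (u v w : E) :
    mvfderiv 𝓘(ℝ, E) (fun y => T.form y (coordField p v y) (coordField p w y)) p
        (coordField p u p) +
      mvfderiv 𝓘(ℝ, E) (fun y => T.form y (coordField p w y) (coordField p u y)) p
        (coordField p v p) +
      mvfderiv 𝓘(ℝ, E) (fun y => T.form y (coordField p u y) (coordField p v y)) p
        (coordField p w p) = 0 := by
  have hd : ∀ (i : Fin 3) (v w : E), MDifferentiableAt 𝓘(ℝ, E) 𝓘(ℝ, ℝ)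
      (fun y => T.g.inner y (T.J i y (coordField p v y)) (coordField p w y)) p := by
    intro i v w
    refine (contMDiffAt_metric_apply T.g ((T.smooth_J i).apply ?_) ?_).mdifferentiableAt (by simp)
    · exact contMDiffAt_coordField (mem_chart_source E p) v
    · exact contMDiffAt_coordField (mem_chart_source E p) w
  have key : ∀ u v w : E,
      mvfderiv 𝓘(ℝ, E) (fun y => T.form y (coordField p v y) (coordField p w y)) p
        (coordField p u p) =
      (mvfderiv 𝓘(ℝ, E) (fun y => T.g.inner y (T.J 1 y (coordField p v y)) (coordField p w y)) p
        (coordField p u p) : ℂ) + Complex.I *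
      (mvfderiv 𝓘(ℝ, E) (fun y => T.g.inner y (T.J 2 y (coordField p v y)) (coordField p w y)) p
        (coordField p u p) : ℂ) :=
    fun u v w => mvfderiv_add_I_mul (hd 1 v w) (hd 2 v w) _
  have c1 := congrArg Complex.ofReal (T.cyclic_kahlerForm 1 p u v w)
  have c2 := congrArg Complex.ofReal (T.cyclic_kahlerForm 2 p u v w)
  push_cast at c1 c2
  rw [key, key, key]
  linear_combination c1 + Complex.I * c2

variable [FiniteDimensional ℝ E] (hd : Module.finrank ℝ E = 4)

include hd

/-- The identity `dF ∧ dG = ½ {F, G} ω` yields smoothness and holomorphy of the bracket as well as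
the Jacobi identity. -/
theorem wedge_eq {U : Set M} {F G : M → ℂ} (hF : IsHolomorphicOn (T.J 0) U F)
    (hG : IsHolomorphicOn (T.J 0) U G) {x : M} (hx : x ∈ U) (u v : TangentSpace 𝓘(ℝ, E) x) :
    mvfderiv 𝓘(ℝ, E) F x u * mvfderiv 𝓘(ℝ, E) G x v -
      mvfderiv 𝓘(ℝ, E) F x v * mvfderiv 𝓘(ℝ, E) G x u =
      1 / 2 * T.pairing F G x * T.form x u v :=
  (T.hyperhermitian x).wedge_eq hd (hF.2 x hx) (hG.2 x hx) u v

/-- Evaluating `dF ∧ dG = ½ {F, G} ω` on `V` and `J₁ V`, for a coordinate field `V` without zeros,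
gives `{F, G}` as a smooth quotient with denominator `g(V, V)`. -/
theorem contMDiffOn_pairing {U : Set M} (hU : IsOpen U) {F G : M → ℂ}
    (hF : IsHolomorphicOn (T.J 0) U F) (hG : IsHolomorphicOn (T.J 0) U G) :
    ContMDiffOn 𝓘(ℝ, E) 𝓘(ℝ, ℂ) ∞ (T.pairing F G) U := by
  intro p hp
  obtain ⟨v, hv⟩ := exists_coordField_ne_zero (E := E) (by omega) p
  have hps := mem_chart_source E p
  have hV : SmoothFieldAt (coordField p v) p := contMDiffAt_coordField hps v
  have hJV := (T.smooth_J 1).apply hV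
  have hFp := hF.1.contMDiffAt (hU.mem_nhds hp)
  have hGp := hG.1.contMDiffAt (hU.mem_nhds hp)
  have hg := contMDiffAt_metric_apply T.g hV hV
  have hg0 : T.g.inner p (coordField p v p) (coordField p v p) ≠ 0 :=
    (T.g.pos p _ (hv p hps)).ne'
  have hnum : ContMDiffAt 𝓘(ℝ, E) 𝓘(ℝ, ℂ) ∞ (fun x =>
      ((T.g.inner x (coordField p v x) (coordField p v x))⁻¹) • ((2 : ℂ) *
      (mvfderiv 𝓘(ℝ, E) F x (coordField p v x) * mvfderiv 𝓘(ℝ, E) G x (T.J 1 x (coordField p v x)) -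
      mvfderiv 𝓘(ℝ, E) F x (T.J 1 x (coordField p v x)) *
        mvfderiv 𝓘(ℝ, E) G x (coordField p v x)))) p :=
    (hg.inv₀ hg0).smul (contMDiffAt_mul_complex contMDiffAt_const ((contMDiffAt_mul_complex
      (contMDiffAt_mvfderiv_apply hFp hV) (contMDiffAt_mvfderiv_apply hGp hJV)).sub
      (contMDiffAt_mul_complex (contMDiffAt_mvfderiv_apply hFp hJV)
        (contMDiffAt_mvfderiv_apply hGp hV))))
  refine (hnum.congr_of_eventuallyEq ?_).contMDiffWithinAt
  filter_upwards [hU.mem_nhds hp, (chartAt E p).open_source.mem_nhds hps] with x hx hxs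
  rw [T.wedge_eq hd hF hG hx, form, (T.hyperhermitian x).holomorphicForm_apply_one]
  have h0 : (T.g.inner x (coordField p v x) (coordField p v x) : ℂ) ≠ 0 := by
    exact_mod_cast (T.g.pos x _ (hv x hxs)).ne'
  rw [Complex.real_smul, Complex.ofReal_inv]
  field_simp

/-- Taking `d` of `{F, G} ω = 2 dF ∧ dG` and using `dω = 0` gives `d{F, G} ∧ ω = 0`, so `d{F, G}` is
of type (1,0). -/
theorem isHolomorphicOn_pairing {U : Set M} (hU : IsOpen U) {F G : M → ℂ}
    (hF : IsHolomorphicOn (T.J 0) U F) (hG : IsHolomorphicOn (T.J 0) U G) :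
    IsHolomorphicOn (T.J 0) U (T.pairing F G) := by
  have hsm := T.contMDiffOn_pairing hd hU hF hG
  refine ⟨hsm, fun p hp => ?_⟩
  refine (T.hyperhermitian p).oneZero_of_wedge_eq_zero fun u v w => ?_
  obtain ⟨u, rfl⟩ := exists_coordField_eq p u
  obtain ⟨v, rfl⟩ := exists_coordField_eq p v
  obtain ⟨w, rfl⟩ := exists_coordField_eq p w
  have hps := mem_chart_source E p
  have hc : ∀ v : E, SmoothFieldAt (coordField p v) p := contMDiffAt_coordField hps
  have hFp := hF.1.contMDiffAt (hU.mem_nhds hp)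
  have hGp := hG.1.contMDiffAt (hU.mem_nhds hp)
  have hPp := hsm.contMDiffAt (hU.mem_nhds hp)
  have hdF : ∀ v : E, MDifferentiableAt 𝓘(ℝ, E) 𝓘(ℝ, ℂ)
      (fun x => mvfderiv 𝓘(ℝ, E) F x (coordField p v x)) p := fun v =>
    (contMDiffAt_mvfderiv_apply hFp (hc v)).mdifferentiableAt (by simp)
  have hdG : ∀ v : E, MDifferentiableAt 𝓘(ℝ, E) 𝓘(ℝ, ℂ)
      (fun x => mvfderiv 𝓘(ℝ, E) G x (coordField p v x)) p := fun v =>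
    (contMDiffAt_mvfderiv_apply hGp (hc v)).mdifferentiableAt (by simp)
  have key : ∀ u v w : E,
      T.pairing F G p * mvfderiv 𝓘(ℝ, E)
        (fun y => T.form y (coordField p v y) (coordField p w y)) p (coordField p u p) +
      T.form p (coordField p v p) (coordField p w p) *
        mvfderiv 𝓘(ℝ, E) (T.pairing F G) p (coordField p u p) =
      2 * ((mvfderiv 𝓘(ℝ, E) F p (coordField p v p) *
        mvfderiv 𝓘(ℝ, E) (fun x => mvfderiv 𝓘(ℝ, E) G x (coordField p w x)) p (coordField p u p) +
        mvfderiv 𝓘(ℝ, E) G p (coordField p w p) *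
        mvfderiv 𝓘(ℝ, E) (fun x => mvfderiv 𝓘(ℝ, E) F x (coordField p v x)) p (coordField p u p)) -
        (mvfderiv 𝓘(ℝ, E) F p (coordField p w p) *
        mvfderiv 𝓘(ℝ, E) (fun x => mvfderiv 𝓘(ℝ, E) G x (coordField p v x)) p (coordField p u p) +
        mvfderiv 𝓘(ℝ, E) G p (coordField p v p) *
        mvfderiv 𝓘(ℝ, E) (fun x => mvfderiv 𝓘(ℝ, E) F x (coordField p w x)) p
          (coordField p u p))) := by
    intro u v w
    have heq : (fun x => T.pairing F G x * T.form x (coordField p v x) (coordField p w x)) =ᶠ[𝓝 p]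
        fun x => (ContinuousLinearMap.lsmul ℝ ℝ (2 : ℝ) : ℂ →L[ℝ] ℂ)
          (mvfderiv 𝓘(ℝ, E) F x (coordField p v x) * mvfderiv 𝓘(ℝ, E) G x (coordField p w x) -
          mvfderiv 𝓘(ℝ, E) F x (coordField p w x) * mvfderiv 𝓘(ℝ, E) G x (coordField p v x)) := by
      filter_upwards [hU.mem_nhds hp] with x hx
      rw [T.wedge_eq hd hF hG hx]
      simp only [ContinuousLinearMap.lsmul_apply, Complex.real_smul, Complex.ofReal_ofNat]
      ring
    have hd1 := mvfderiv_mul_complex (hPp.mdifferentiableAt (by simp))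
      ((T.contMDiffAt_form (hc v) (hc w)).mdifferentiableAt (by simp)) (coordField p u p)
    have hm : MDifferentiableAt 𝓘(ℝ, E) 𝓘(ℝ, ℂ) (fun x =>
        mvfderiv 𝓘(ℝ, E) F x (coordField p v x) * mvfderiv 𝓘(ℝ, E) G x (coordField p w x) -
        mvfderiv 𝓘(ℝ, E) F x (coordField p w x) * mvfderiv 𝓘(ℝ, E) G x (coordField p v x)) p :=
      ((hdF v).mul (hdG w)).sub ((hdF w).mul (hdG v))
    rw [← hd1, mvfderiv_congr heq, mvfderiv_clm_comp _ hm]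
    rw [mvfderiv_mul_sub_mul (hdF v) (hdG w) (hdF w) (hdG v)]
    simp
  have hcyc := T.cyclic_form p u v w
  have k1 := key u v w
  have k2 := key v w u
  have k3 := key w u v
  -- Symmetry of second derivatives, that is `d(dF ∧ dG) = 0`: after these swaps the cyclic sum of
  -- the right-hand sides cancels.
  rw [mvfderiv_coordField_comm hFp v u, mvfderiv_coordField_comm hGp v u] at k1
  rw [mvfderiv_coordField_comm hFp w v, mvfderiv_coordField_comm hGp w v] at k2
  rw [mvfderiv_coordField_comm hFp u w, mvfderiv_coordField_comm hGp u w] at k3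
  change mvfderiv 𝓘(ℝ, E) (T.pairing F G) p (coordField p u p) * T.form p _ _ +
    mvfderiv 𝓘(ℝ, E) (T.pairing F G) p (coordField p v p) * T.form p _ _ +
    mvfderiv 𝓘(ℝ, E) (T.pairing F G) p (coordField p w p) * T.form p _ _ = 0
  linear_combination k1 + k2 + k3 - T.pairing F G p * hcyc

end ClosedTriple

end ClosedTriple

/-! ### Holomorphic Poisson bivectors of a closed triple -/

section HolomorphicFunctions

variable {E : Type*} [NormedAddCommGroup E] [NormedSpace ℝ E]
  {M : Type*} [TopologicalSpace M] [ChartedSpace E M]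
  {J : ∀ x : M, TangentSpace 𝓘(ℝ, E) x →L[ℝ] TangentSpace 𝓘(ℝ, E) x} {U : Set M} {F G : M → ℂ}

theorem IsHolomorphicOn.contMDiffAt (hF : IsHolomorphicOn J U F) (hU : IsOpen U) {x : M}
    (hx : x ∈ U) : ContMDiffAt 𝓘(ℝ, E) 𝓘(ℝ, ℂ) ∞ F x :=
  hF.1.contMDiffAt (hU.mem_nhds hx)

theorem IsHolomorphicOn.mdifferentiableAt (hF : IsHolomorphicOn J U F) (hU : IsOpen U) {x : M}
    (hx : x ∈ U) : MDifferentiableAt 𝓘(ℝ, E) 𝓘(ℝ, ℂ) F x :=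
  (hF.contMDiffAt hU hx).mdifferentiableAt (by simp)

theorem IsHolomorphicOn.congr (hF : IsHolomorphicOn J U F) (hU : IsOpen U)
    (h : ∀ x ∈ U, G x = F x) : IsHolomorphicOn J U G := by
  refine ⟨hF.1.congr h, fun x hx v => ?_⟩
  have heq : G =ᶠ[𝓝 x] F := by
    filter_upwards [hU.mem_nhds hx] with y hy using h y hy
  rw [mvfderiv_congr heq]
  exact hF.2 x hx v

theorem IsHolomorphicOn.mono {U' : Set M} (hF : IsHolomorphicOn J U F) (h : U' ⊆ U) :
    IsHolomorphicOn J U' F :=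
  ⟨hF.1.mono h, fun x hx => hF.2 x (h hx)⟩

theorem IsHolomorphicOn.mul (hF : IsHolomorphicOn J U F) (hG : IsHolomorphicOn J U G)
    (hU : IsOpen U) : IsHolomorphicOn J U (fun x => F x * G x) := by
  refine ⟨fun x hx => (contMDiffAt_mul_complex (hF.contMDiffAt hU hx)
    (hG.contMDiffAt hU hx)).contMDiffWithinAt, fun x hx v => ?_⟩
  rw [mvfderiv_mul_complex (hF.mdifferentiableAt hU hx) (hG.mdifferentiableAt hU hx),
    mvfderiv_mul_complex (hF.mdifferentiableAt hU hx) (hG.mdifferentiableAt hU hx),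
    hF.2 x hx, hG.2 x hx]
  ring

/-- A quotient of holomorphic functions is holomorphic where the denominator does not vanish. -/
theorem IsHolomorphicOn.of_mul_eq {f : M → ℂ} (hF : IsHolomorphicOn J U F)
    (hG : IsHolomorphicOn J U G) (hU : IsOpen U) (h0 : ∀ x ∈ U, G x ≠ 0)
    (hf : ∀ x ∈ U, f x * G x = F x) : IsHolomorphicOn J U f := by
  have hsm : ∀ x ∈ U, ContMDiffAt 𝓘(ℝ, E) 𝓘(ℝ, ℂ) ∞ f x := by
    intro x hx
    have hinv : ContMDiffAt 𝓘(ℝ, E) 𝓘(ℝ, ℂ) ∞ (fun y => (G y)⁻¹) x :=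
      ((contDiffAt_inv ℝ (h0 x hx)).contMDiffAt).comp x (hG.contMDiffAt hU hx)
    refine (contMDiffAt_mul_complex (hF.contMDiffAt hU hx) hinv).congr_of_eventuallyEq ?_
    filter_upwards [hU.mem_nhds hx] with y hy
    rw [← hf y hy, mul_assoc, mul_inv_cancel₀ (h0 y hy), mul_one]
  refine ⟨fun x hx => (hsm x hx).contMDiffWithinAt, fun x hx v => ?_⟩
  have heq : (fun y => f y * G y) =ᶠ[𝓝 x] F := by
    filter_upwards [hU.mem_nhds hx] with y hy using hf y hy
  have hd := mvfderiv_mul_complex (E := E) ((hsm x hx).mdifferentiableAt (by simp))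
    (hG.mdifferentiableAt hU hx)
  rw [mvfderiv_congr heq] at hd
  have h1 := hF.2 x hx v
  rw [hd, hd, hG.2 x hx] at h1
  refine mul_left_cancel₀ (h0 x hx) ?_
  linear_combination h1

end HolomorphicFunctions

namespace ClosedTriple

set_option linter.unusedSectionVars false

variable {E : Type*} [NormedAddCommGroup E] [NormedSpace ℝ E] [FiniteDimensional ℝ E]
  {M : Type*} [TopologicalSpace M] [ChartedSpace E M] [IsManifold 𝓘(ℝ, E) ∞ M]
  (T : ClosedTriple E M)

/-- The bivector field `f₀ ω₀⁻¹ + f₁ ω₁⁻¹ + f₂ ω₂⁻¹`. -/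
def bivectorOf (f : Fin 3 → M → ℝ) (x : M) :
    (TangentSpace 𝓘(ℝ, E) x →L[ℝ] ℝ) →L[ℝ] TangentSpace 𝓘(ℝ, E) x :=
  ∑ i, f i x • dualBivector ((T.g.inner x).comp (T.J i x))

/-- On `J 0`-holomorphic functions the bracket sees only `f₁ + i f₂`, as a factor in front of the
bracket of `ω₁⁻¹`. -/
theorem bracket_eq (f : Fin 3 → M → ℝ) {U : Set M} {F G : M → ℂ}
    (hF : IsHolomorphicOn (T.J 0) U F) (hG : IsHolomorphicOn (T.J 0) U G) {x : M} (hx : x ∈ U) :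
    bracket (fun x => twoZeroPart (T.J 0 x) (T.bivectorOf f x)) F G x =
      ((f 1 x : ℂ) + Complex.I * (f 2 x : ℂ)) * T.pairing F G x :=
  (T.hyperhermitian x).twoZeroPart_sum_dualBivector (fun i => f i x) (hF.2 x hx) (hG.2 x hx)

theorem pairing_swap (F G : M → ℂ) (x : M) : T.pairing F G x = -T.pairing G F x :=
  (T.hyperhermitian x).holomorphicPairing_swap _ _

variable (hd : Module.finrank ℝ E = 4)

include hd

/-- Taking `d` of `a dF + b dG + c dH = 0` gives `da ∧ dF + db ∧ dG + dc ∧ dH = 0`, and each wedge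
is half the corresponding bracket times the nondegenerate form `ω`. -/
theorem pairing_jacobi {U : Set M} (hU : IsOpen U) {F G H a b c : M → ℂ}
    (hF : IsHolomorphicOn (T.J 0) U F) (hG : IsHolomorphicOn (T.J 0) U G)
    (hH : IsHolomorphicOn (T.J 0) U H) (ha : IsHolomorphicOn (T.J 0) U a)
    (hb : IsHolomorphicOn (T.J 0) U b) (hc : IsHolomorphicOn (T.J 0) U c)
    (hzero : ∀ x ∈ U, ∀ u : TangentSpace 𝓘(ℝ, E) x, a x * mvfderiv 𝓘(ℝ, E) F x u +
      b x * mvfderiv 𝓘(ℝ, E) G x u + c x * mvfderiv 𝓘(ℝ, E) H x u = 0) {p : M} (hp : p ∈ U) :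
    T.pairing a F p + T.pairing b G p + T.pairing c H p = 0 := by
  have : CompleteSpace E := FiniteDimensional.complete ℝ E
  have hps := mem_chart_source E p
  have key : ∀ v w : E,
      (a p * mvfderiv 𝓘(ℝ, E) (fun x => mvfderiv 𝓘(ℝ, E) F x (coordField p v x)) p
          (coordField p w p) + mvfderiv 𝓘(ℝ, E) F p (coordField p v p) *
          mvfderiv 𝓘(ℝ, E) a p (coordField p w p)) +
      (b p * mvfderiv 𝓘(ℝ, E) (fun x => mvfderiv 𝓘(ℝ, E) G x (coordField p v x)) p
          (coordField p w p) + mvfderiv 𝓘(ℝ, E) G p (coordField p v p) *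
          mvfderiv 𝓘(ℝ, E) b p (coordField p w p)) +
      (c p * mvfderiv 𝓘(ℝ, E) (fun x => mvfderiv 𝓘(ℝ, E) H x (coordField p v x)) p
          (coordField p w p) + mvfderiv 𝓘(ℝ, E) H p (coordField p v p) *
          mvfderiv 𝓘(ℝ, E) c p (coordField p w p)) = 0 := by
    intro v w
    have hdd : ∀ {F : M → ℂ}, IsHolomorphicOn (T.J 0) U F → MDifferentiableAt 𝓘(ℝ, E) 𝓘(ℝ, ℂ)
        (fun x => mvfderiv 𝓘(ℝ, E) F x (coordField p v x)) p := fun hF =>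
      (contMDiffAt_mvfderiv_apply (hF.contMDiffAt hU hp)
        (contMDiffAt_coordField hps v)).mdifferentiableAt (by simp)
    have ma := mvfderiv_mul_complex (ha.mdifferentiableAt hU hp) (hdd hF) (coordField p w p)
    have mb := mvfderiv_mul_complex (hb.mdifferentiableAt hU hp) (hdd hG) (coordField p w p)
    have mc := mvfderiv_mul_complex (hc.mdifferentiableAt hU hp) (hdd hH) (coordField p w p)
    rw [← ma, ← mb, ← mc]
    have da : MDifferentiableAt 𝓘(ℝ, E) 𝓘(ℝ, ℂ)
        (fun x => a x * mvfderiv 𝓘(ℝ, E) F x (coordField p v x)) p :=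
      (ha.mdifferentiableAt hU hp).mul (hdd hF)
    have db : MDifferentiableAt 𝓘(ℝ, E) 𝓘(ℝ, ℂ)
        (fun x => b x * mvfderiv 𝓘(ℝ, E) G x (coordField p v x)) p :=
      (hb.mdifferentiableAt hU hp).mul (hdd hG)
    have dc : MDifferentiableAt 𝓘(ℝ, E) 𝓘(ℝ, ℂ)
        (fun x => c x * mvfderiv 𝓘(ℝ, E) H x (coordField p v x)) p :=
      (hc.mdifferentiableAt hU hp).mul (hdd hH)
    have dab := mvfderiv_fun_add (I := 𝓘(ℝ, E)) da db
    have dabc := mvfderiv_fun_add (I := 𝓘(ℝ, E)) (da.add db) dc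
    have heq : (fun x => a x * mvfderiv 𝓘(ℝ, E) F x (coordField p v x) +
        b x * mvfderiv 𝓘(ℝ, E) G x (coordField p v x) +
        c x * mvfderiv 𝓘(ℝ, E) H x (coordField p v x)) =ᶠ[𝓝 p] fun _ => (0 : ℂ) := by
      filter_upwards [hU.mem_nhds hp] with x hx using hzero x hx _
    have h0 := mvfderiv_congr (E := E) heq
    rw [mvfderiv_const] at h0
    have h1 := (dabc.symm.trans h0)
    have h2 := congrArg (fun L => L (coordField p w p)) h1
    have h3 := congrArg (fun L => L (coordField p w p)) dab
    simp only [add_apply] at h2 h3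
    rw [← h3]
    exact h2
  -- Antisymmetrising `key` in `v, w` removes the second derivatives and leaves the wedge products.
  have anti : ∀ v w : TangentSpace 𝓘(ℝ, E) p,
      (T.pairing a F p + T.pairing b G p + T.pairing c H p) * T.form p w v = 0 := by
    intro v w
    obtain ⟨v, rfl⟩ := exists_coordField_eq p v
    obtain ⟨w, rfl⟩ := exists_coordField_eq p w
    have k1 := key v w
    have k2 := key w v
    rw [mvfderiv_coordField_comm (hF.contMDiffAt hU hp) v w,
      mvfderiv_coordField_comm (hG.contMDiffAt hU hp) v w,
      mvfderiv_coordField_comm (hH.contMDiffAt hU hp) v w] at k1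
    have wa := T.wedge_eq hd ha hF hp (coordField p w p) (coordField p v p)
    have wb := T.wedge_eq hd hb hG hp (coordField p w p) (coordField p v p)
    have wc := T.wedge_eq hd hc hH hp (coordField p w p) (coordField p v p)
    linear_combination 2 * (k1 - k2) - 2 * (wa + wb + wc)
  obtain ⟨v, hv⟩ := exists_coordField_ne_zero (E := E) (by omega) p
  have h1 := anti (T.J 1 p (coordField p v p)) (coordField p v p)
  rw [form, (T.hyperhermitian p).holomorphicForm_apply_one] at h1
  refine (mul_eq_zero.1 h1).resolve_right ?_
  exact_mod_cast (T.g.pos p _ (hv p hps)).ne'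

/-- If `f₁ + i f₂` is holomorphic, then the `(2,0)`-part of `f₀ ω₀⁻¹ + f₁ ω₁⁻¹ + f₂ ω₂⁻¹` is a
holomorphic Poisson bivector. -/
theorem isHolomorphicPoisson (f : Fin 3 → M → ℝ)
    (hf : IsHolomorphicOn (T.J 0) Set.univ
      (fun x => (f 1 x : ℂ) + Complex.I * (f 2 x : ℂ))) :
    IsHolomorphicPoisson (T.J 0) (fun x => twoZeroPart (T.J 0 x) (T.bivectorOf f x)) := by
  have : CompleteSpace E := FiniteDimensional.complete ℝ E
  have hol : ∀ (U : Set M) (F G : M → ℂ), IsOpen U →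
      IsHolomorphicOn (T.J 0) U F → IsHolomorphicOn (T.J 0) U G → IsHolomorphicOn (T.J 0) U
        (bracket (fun x => twoZeroPart (T.J 0 x) (T.bivectorOf f x)) F G) := by
    intro U F G hU hF hG
    exact ((hf.mono (Set.subset_univ U)).mul (T.isHolomorphicOn_pairing hd hU hF hG) hU).congr hU
      fun x hx => T.bracket_eq f hF hG hx
  refine ⟨fun x => isTypeTwoZero_twoZeroPart ((T.hyperhermitian x).sq 0)
    ((T.hyperhermitian x).sum_dualBivector_alternating fun i => f i x), hol, ?_⟩
  intro U F G H hU hF hG hH x hx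
  have hFG := hol U F G hU hF hG
  have hGH := hol U G H hU hG hH
  have hHF := hol U H F hU hH hF
  rw [T.bracket_eq f hF hGH hx, T.bracket_eq f hG hHF hx, T.bracket_eq f hH hFG hx,
    T.pairing_swap F, T.pairing_swap G, T.pairing_swap H]
  -- The coefficients are the brackets themselves, `a = {G, H}` and so on, with the factor `f₁ + i
  -- f₂` included. The relation they must satisfy is `holomorphicPairing_cyclic` multiplied by that
  -- factor.
  have := T.pairing_jacobi hd hU hF hG hH hGH hHF hFG (fun y hy u => by
    rw [T.bracket_eq f hG hH hy, T.bracket_eq f hH hF hy, T.bracket_eq f hF hG hy]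
    have h := (T.hyperhermitian y).holomorphicPairing_cyclic hd (hF.2 y hy) (hG.2 y hy)
      (hH.2 y hy) u
    change T.pairing F G y * _ + T.pairing G H y * _ + T.pairing H F y * _ = 0 at h
    linear_combination ((f 1 y : ℂ) + Complex.I * (f 2 y : ℂ)) * h) hx
  linear_combination (-((f 1 x : ℂ) + Complex.I * (f 2 x : ℂ))) * this

/-- If the `(2,0)`-part of `f₀ ω₀⁻¹ + f₁ ω₁⁻¹ + f₂ ω₂⁻¹` is a holomorphic Poisson bivector, then
`f₁ + i f₂` is holomorphic. -/
theorem isHolomorphicOn_of_isHolomorphicPoisson (hJ : IsComplexStructure (T.J 0))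
    (f : Fin 3 → M → ℝ)
    (hP : IsHolomorphicPoisson (T.J 0) (fun x => twoZeroPart (T.J 0 x) (T.bivectorOf f x))) :
    IsHolomorphicOn (T.J 0) Set.univ (fun x => (f 1 x : ℂ) + Complex.I * (f 2 x : ℂ)) := by
  have : CompleteSpace E := FiniteDimensional.complete ℝ E
  suffices hloc : ∀ p : M, ∃ W : Set M, IsOpen W ∧ p ∈ W ∧
      IsHolomorphicOn (T.J 0) W (fun x => (f 1 x : ℂ) + Complex.I * (f 2 x : ℂ)) by
    refine ⟨fun p _ => ?_, fun p _ => ?_⟩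
    · obtain ⟨W, hW, hp, h⟩ := hloc p
      exact (h.contMDiffAt hW hp).contMDiffWithinAt
    · obtain ⟨W, hW, hp, h⟩ := hloc p
      exact h.2 p hp
  intro p
  obtain ⟨n, z, hp, hz, hzs⟩ := hJ p
  have hzp : ContMDiffAt 𝓘(ℝ, E) 𝓘(ℝ, Fin n → ℂ) ∞ z p :=
    contMDiffAt_pi_space.2 fun k => (hz k).contMDiffAt z.open_source hp
  -- The differentials of holomorphic coordinates have no common zero, because the coordinate map
  -- has a smooth inverse.
  have hinj : ∀ v : TangentSpace 𝓘(ℝ, E) p,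
      (∀ k, mvfderiv 𝓘(ℝ, E) (fun x => z x k) p v = 0) → v = 0 := by
    intro v hv
    have hzv : mvfderiv 𝓘(ℝ, E) z p v = 0 := by
      funext k
      have := mvfderiv_clm_comp (ContinuousLinearMap.proj (R := ℝ) (φ := fun _ : Fin n => ℂ) k)
        (hzp.mdifferentiableAt (by simp)) v
      exact this.symm.trans (hv k)
    have hs : MDifferentiableAt 𝓘(ℝ, Fin n → ℂ) 𝓘(ℝ, E) z.symm (z p) :=
      (hzs.contMDiffAt (z.open_target.mem_nhds (z.map_source hp))).mdifferentiableAt (by simp)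
    have hcomp := mfderiv_comp_apply p hs (hzp.mdifferentiableAt (by simp)) v
    have hid : (z.symm ∘ z) =ᶠ[𝓝 p] id := by
      filter_upwards [z.open_source.mem_nhds hp] with y hy using z.left_inv hy
    rw [hid.mfderiv_eq, mfderiv_id] at hcomp
    have hzv' : mfderiv 𝓘(ℝ, E) 𝓘(ℝ, Fin n → ℂ) z p v = 0 := hzv
    rw [hzv', map_zero] at hcomp
    exact hcomp
  obtain ⟨i, j, hij⟩ := (T.hyperhermitian p).exists_holomorphicPairing_ne_zero hd
    (α := fun k => mvfderiv 𝓘(ℝ, E) (fun x => z x k) p) (fun k => (hz k).2 p hp) hinj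
  have hh := T.isHolomorphicOn_pairing hd z.open_source (hz i) (hz j)
  have hK := hP.holomorphic _ _ _ z.open_source (hz i) (hz j)
  -- Where the bracket `{zᵢ, zⱼ}` of two coordinates is nonzero, `f₁ + i f₂` is the quotient of the
  -- two holomorphic brackets of `zᵢ, zⱼ`.
  refine ⟨z.source ∩ T.pairing (fun x => z x i) (fun x => z x j) ⁻¹' {0}ᶜ,
    hh.1.continuousOn.isOpen_inter_preimage z.open_source isOpen_compl_singleton, ⟨hp, hij⟩, ?_⟩
  refine (hK.mono Set.inter_subset_left).of_mul_eq (hh.mono Set.inter_subset_left)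
    (hh.1.continuousOn.isOpen_inter_preimage z.open_source isOpen_compl_singleton)
    (fun x hx => hx.2) fun x hx => ?_
  exact (T.bracket_eq f (hz i) (hz j) hx.1).symm

end ClosedTriple

/-! ### Rotations of a hyperhermitian triple -/

section Rotation

/-- The rows of `R` form a positively oriented orthonormal frame of `ℝ³`. -/
structure IsFrame (R : Fin 3 → Fin 3 → ℝ) : Prop where
  row : ∀ i j, ∑ k, R i k * R j k = if i = j then 1 else 0
  cross_zero : R 2 0 = R 0 1 * R 1 2 - R 0 2 * R 1 1
  cross_one : R 2 1 = R 0 2 * R 1 0 - R 0 0 * R 1 2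
  cross_two : R 2 2 = R 0 0 * R 1 1 - R 0 1 * R 1 0

theorem IsFrame.column {R : Fin 3 → Fin 3 → ℝ} (hR : IsFrame R) (i j : Fin 3) :
    ∑ k, R k i * R k j = if i = j then 1 else 0 := by
  have h1 : Matrix.of R * (Matrix.of R).transpose = 1 := by
    ext i j
    rw [Matrix.mul_apply, Matrix.one_apply]
    exact hR.row i j
  have h2 : ((Matrix.of R).transpose * Matrix.of R) i j = (1 : Matrix (Fin 3) (Fin 3) ℝ) i j := by
    rw [mul_eq_one_comm.1 h1]
  rw [Matrix.mul_apply, Matrix.one_apply] at h2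
  exact h2

theorem isFrame_of_orthonormal {a b : Fin 3 → ℝ} (ha : ∑ i, a i ^ 2 = 1) (hb : ∑ i, b i ^ 2 = 1)
    (hab : ∑ i, a i * b i = 0) :
    IsFrame ![a, b, ![a 1 * b 2 - a 2 * b 1, a 2 * b 0 - a 0 * b 2, a 0 * b 1 - a 1 * b 0]] := by
  rw [Fin.sum_univ_three] at ha hb hab
  refine ⟨fun i j => ?_, rfl, rfl, rfl⟩
  rw [Fin.sum_univ_three]
  fin_cases i <;> fin_cases j <;> simp
  · linear_combination ha
  · linear_combination hab
  · ring
  · linear_combination hab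
  · linear_combination hb
  · ring
  · ring
  · ring
  · linear_combination (b 0 ^ 2 + b 1 ^ 2 + b 2 ^ 2) * ha + hb -
      (a 0 * b 0 + a 1 * b 1 + a 2 * b 2) * hab

/-- The second vector is the horizontal projection of `a`, turned by a right angle and normalised;
for vertical `a` it is a coordinate vector. The third is the cross product. -/
theorem exists_isFrame {a : Fin 3 → ℝ} (ha : ∑ i, a i ^ 2 = 1) : ∃ R, IsFrame R ∧ R 0 = a := by
  suffices h : ∃ b : Fin 3 → ℝ, ∑ i, b i ^ 2 = 1 ∧ ∑ i, a i * b i = 0 by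
    obtain ⟨b, hb, hab⟩ := h
    exact ⟨_, isFrame_of_orthonormal ha hb hab, rfl⟩
  by_cases h0 : a 0 ^ 2 + a 1 ^ 2 = 0
  · have h00 : a 0 = 0 := by nlinarith [sq_nonneg (a 0), sq_nonneg (a 1)]
    exact ⟨![1, 0, 0], by simp [Fin.sum_univ_three], by simp [Fin.sum_univ_three, h00]⟩
  · have hp : 0 < a 0 ^ 2 + a 1 ^ 2 := lt_of_le_of_ne (by positivity) (Ne.symm h0)
    have hs := Real.sq_sqrt hp.le
    have hs0 : Real.sqrt (a 0 ^ 2 + a 1 ^ 2) ≠ 0 := (Real.sqrt_pos.2 hp).ne'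
    refine ⟨![-a 1 / Real.sqrt (a 0 ^ 2 + a 1 ^ 2), a 0 / Real.sqrt (a 0 ^ 2 + a 1 ^ 2), 0],
      ?_, ?_⟩
    · simp only [Fin.sum_univ_three, Matrix.cons_val_zero, Matrix.cons_val_one, Matrix.cons_val]
      rw [div_pow, div_pow, hs]
      field_simp
      ring
    · simp only [Fin.sum_univ_three, Matrix.cons_val_zero, Matrix.cons_val_one, Matrix.cons_val]
      ring

variable {V : Type*} [AddCommGroup V] [Module ℝ V] [TopologicalSpace V]
  [IsTopologicalAddGroup V] [ContinuousSMul ℝ V]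
  {g : V →L[ℝ] V →L[ℝ] ℝ} {J : Fin 3 → V →L[ℝ] V}

/-- The product of imaginary quaternions, `-⟨a, b⟩ + a × b`. Hence oriented orthonormal frames give
quaternionic triples again. -/
theorem IsHyperhermitian.combination_mul (h : IsHyperhermitian g J) (a b : Fin 3 → ℝ) (v : V) :
    combination J a (combination J b v) = -(∑ k, a k * b k) • v +
      ((a 1 * b 2 - a 2 * b 1) • J 0 v + (a 2 * b 0 - a 0 * b 2) • J 1 v +
        (a 0 * b 1 - a 1 * b 0) • J 2 v) := by
  simp only [combination_apply, map_add, map_smul, h.sq, h.mul, h.mul_one_zero, h.mul_one_two,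
    h.mul_two_one, h.mul_zero_two, h.mul_two_zero, Fin.sum_univ_three]
  module

theorem IsHyperhermitian.rotate (h : IsHyperhermitian g J) {R : Fin 3 → Fin 3 → ℝ}
    (hR : IsFrame R) : IsHyperhermitian g (fun i => combination J (R i)) := by
  have hsq : ∀ i v, combination J (R i) (combination J (R i) v) = -v := by
    intro i v
    rw [h.combination_mul, hR.row, if_pos rfl]
    module
  refine ⟨h.symm, h.pos, hsq, fun v => ?_, fun i u v => ?_⟩
  · rw [h.combination_mul, hR.row, combination_apply, hR.cross_zero, hR.cross_one, hR.cross_two]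
    simp
  · have hskew : ∀ u v, g (combination J (R i) u) v = -g u (combination J (R i) v) := by
      intro u v
      simp only [combination_apply, map_add, map_smul, add_apply, smul_apply, smul_eq_mul,
        h.skew _ u]
      ring
    rw [hskew, hsq]
    simp

/-- The coefficients rotate by the same orthogonal matrix as the triple, so the bivector is
unchanged because `RᵀR = 1`. -/
theorem IsHyperhermitian.sum_dualBivector_rotate [T2Space V] [FiniteDimensional ℝ V]
    (h : IsHyperhermitian g J) {R : Fin 3 → Fin 3 → ℝ} (hR : IsFrame R) (f : Fin 3 → ℝ) :
    ∑ i, (∑ j, R i j * f j) • dualBivector (g.comp (combination J (R i))) =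
      ∑ i, f i • dualBivector (g.comp (J i)) := by
  refine h.ext_flat fun b => ?_
  rw [h.sum_dualBivector_flat, (h.rotate hR).sum_dualBivector_flat]
  have c00 := hR.column 0 0
  have c01 := hR.column 0 1
  have c02 := hR.column 0 2
  have c11 := hR.column 1 1
  have c12 := hR.column 1 2
  have c22 := hR.column 2 2
  simp only [Fin.sum_univ_three] at c00 c01 c02 c11 c12 c22
  simp only [Fin.sum_univ_three, combination_apply]
  simp only [if_true, Fin.reduceEq, if_false] at c00 c01 c02 c11 c12 c22
  linear_combination (norm := module) (-f 0 * c00 - f 1 * c01 - f 2 * c02) • J 0 b +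
    (-f 0 * c01 - f 1 * c11 - f 2 * c12) • J 1 b + (-f 0 * c02 - f 1 * c12 - f 2 * c22) • J 2 b

end Rotation

/-! ### Rotating a hyperkähler structure into a closed triple. -/

section Hyperkahler

set_option linter.unusedSectionVars false

variable {E : Type*} [NormedAddCommGroup E] [NormedSpace ℝ E]
  {M : Type*} [TopologicalSpace M] [ChartedSpace E M]

theorem mvfderiv_linear_combination {a b c : M → ℝ} {x : M}
    (ha : MDifferentiableAt 𝓘(ℝ, E) 𝓘(ℝ, ℝ) a x) (hb : MDifferentiableAt 𝓘(ℝ, E) 𝓘(ℝ, ℝ) b x)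
    (hc : MDifferentiableAt 𝓘(ℝ, E) 𝓘(ℝ, ℝ) c x) (r : Fin 3 → ℝ) (v : TangentSpace 𝓘(ℝ, E) x) :
    mvfderiv 𝓘(ℝ, E) (fun y => r 0 * a y + r 1 * b y + r 2 * c y) x v =
      r 0 * mvfderiv 𝓘(ℝ, E) a x v + r 1 * mvfderiv 𝓘(ℝ, E) b x v +
        r 2 * mvfderiv 𝓘(ℝ, E) c x v := by
  have habc : MDifferentiableAt 𝓘(ℝ, E) 𝓘(ℝ, ℝ × ℝ × ℝ) (fun y => (a y, b y, c y)) x :=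
    ha.prodMk_space (hb.prodMk_space hc)
  have h1 := mvfderiv_clm_comp (ContinuousLinearMap.fst ℝ ℝ (ℝ × ℝ)) habc v
  have h2 := mvfderiv_clm_comp ((ContinuousLinearMap.fst ℝ ℝ ℝ).comp
    (ContinuousLinearMap.snd ℝ ℝ (ℝ × ℝ))) habc v
  have h3 := mvfderiv_clm_comp ((ContinuousLinearMap.snd ℝ ℝ ℝ).comp
    (ContinuousLinearMap.snd ℝ ℝ (ℝ × ℝ))) habc v
  have h := mvfderiv_clm_comp (r 0 • ContinuousLinearMap.fst ℝ ℝ (ℝ × ℝ) +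
    r 1 • (ContinuousLinearMap.fst ℝ ℝ ℝ).comp (ContinuousLinearMap.snd ℝ ℝ (ℝ × ℝ)) +
    r 2 • (ContinuousLinearMap.snd ℝ ℝ ℝ).comp (ContinuousLinearMap.snd ℝ ℝ (ℝ × ℝ))) habc v
  simp only [add_apply, smul_apply, smul_eq_mul] at h
  rw [← h1, ← h2, ← h3] at h
  exact h

variable [IsManifold 𝓘(ℝ, E) ∞ M]

namespace HyperkahlerStructure

variable (S : HyperkahlerStructure E M)

theorem isHyperhermitian (x : M) : IsHyperhermitian (S.g.inner x) (fun i => S.J i x) :=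
  ⟨S.g.symm x, S.g.pos x, fun i => S.J_sq i x, S.J_mul x, fun i => S.hermitian i x⟩

theorem isClosedTwoForm_combination (r : Fin 3 → ℝ) :
    IsClosedTwoForm (fun x => (S.g.inner x).comp (combination (fun i => S.J i x) r)) := by
  intro U X Y Z hU hX hY hZ x hx
  have hat : ∀ {X : ∀ x : M, TangentSpace 𝓘(ℝ, E) x}, IsSmoothVectorFieldOn U X →
      SmoothFieldAt X x := fun hX => hX.contMDiffAt (hU.mem_nhds hx)
  have hfun : ∀ Y Z : ∀ x : M, TangentSpace 𝓘(ℝ, E) x,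
      (fun y => ((S.g.inner y).comp (combination (fun i => S.J i y) r)) (Y y) (Z y)) = fun y =>
        r 0 * ((S.g.inner y).comp (S.J 0 y)) (Y y) (Z y) +
        r 1 * ((S.g.inner y).comp (S.J 1 y)) (Y y) (Z y) +
        r 2 * ((S.g.inner y).comp (S.J 2 y)) (Y y) (Z y) := by
    intro Y Z
    funext y
    simp [combination_apply]
  have hder : ∀ {Y Z : ∀ x : M, TangentSpace 𝓘(ℝ, E) x} (_ : IsSmoothVectorFieldOn U Y)
      (_ : IsSmoothVectorFieldOn U Z) (v : TangentSpace 𝓘(ℝ, E) x),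
      mvfderiv 𝓘(ℝ, E)
        (fun y => ((S.g.inner y).comp (combination (fun i => S.J i y) r)) (Y y) (Z y)) x v =
        r 0 * mvfderiv 𝓘(ℝ, E) (fun y => ((S.g.inner y).comp (S.J 0 y)) (Y y) (Z y)) x v +
        r 1 * mvfderiv 𝓘(ℝ, E) (fun y => ((S.g.inner y).comp (S.J 1 y)) (Y y) (Z y)) x v +
        r 2 * mvfderiv 𝓘(ℝ, E) (fun y => ((S.g.inner y).comp (S.J 2 y)) (Y y) (Z y)) x v := by
    intro Y Z hY hZ v
    have hd : ∀ i, MDifferentiableAt 𝓘(ℝ, E) 𝓘(ℝ, ℝ)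
        (fun y => ((S.g.inner y).comp (S.J i y)) (Y y) (Z y)) x := fun i =>
      (contMDiffAt_metric_apply S.g ((S.smooth_J i).apply (hat hY)) (hat hZ)).mdifferentiableAt
        (by simp)
    rw [hfun]
    exact mvfderiv_linear_combination (hd 0) (hd 1) (hd 2) r v
  have c0 := S.closed 0 U X Y Z hU hX hY hZ x hx
  have c1 := S.closed 1 U X Y Z hU hX hY hZ x hx
  have c2 := S.closed 2 U X Y Z hU hX hY hZ x hx
  have hval : ∀ u v : TangentSpace 𝓘(ℝ, E) x,
      ((S.g.inner x).comp (combination (fun i => S.J i x) r)) u v =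
        r 0 * ((S.g.inner x).comp (S.J 0 x)) u v + r 1 * ((S.g.inner x).comp (S.J 1 x)) u v +
        r 2 * ((S.g.inner x).comp (S.J 2 x)) u v := by
    intro u v
    simp [combination_apply]
  rw [extDerivTwoForm] at c0 c1 c2 ⊢
  rw [hder hY hZ, hder hZ hX, hder hX hY, hval, hval, hval]
  linear_combination r 0 * c0 + r 1 * c1 + r 2 * c2

theorem isSmoothEndomorphism_combination (r : Fin 3 → ℝ) :
    IsSmoothEndomorphism (fun x => combination (fun i => S.J i x) r) := by
  intro x
  exact ContMDiffAt.sum_section (fun i _ =>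
    (contMDiffAt_const (c := r i)).smul_section (S.smooth_J i x))

/-- The closed triple obtained from a hyperkähler structure by a rotation. -/
def rotate {R : Fin 3 → Fin 3 → ℝ} (hR : IsFrame R) : ClosedTriple E M where
  g := S.g
  J i x := combination (fun i => S.J i x) (R i)
  smooth_J i := S.isSmoothEndomorphism_combination (R i)
  hyperhermitian x := (S.isHyperhermitian x).rotate hR
  closed i := S.isClosedTwoForm_combination (R i)

theorem rotate_bivectorOf [FiniteDimensional ℝ E] {R : Fin 3 → Fin 3 → ℝ} (hR : IsFrame R)
    (f : Fin 3 → M → ℝ) :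
    (S.rotate hR).bivectorOf (fun i x => ∑ j, R i j * f j x) = S.bivectorOf f := by
  funext x
  exact (S.isHyperhermitian x).sum_dualBivector_rotate hR fun i => f i x

end HyperkahlerStructure

end Hyperkahler

/-! ### Hyper-Poisson bivectors and tri-Hamiltonian vector fields -/

section Hyperkahler

set_option linter.unusedSectionVars false

variable {E : Type*} [NormedAddCommGroup E] [NormedSpace ℝ E] [FiniteDimensional ℝ E]
  {M : Type*} [TopologicalSpace M] [ChartedSpace E M] [IsManifold 𝓘(ℝ, E) ∞ M]

/-- The differential of a smooth function is a smooth section of the cotangent bundle. -/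
theorem contMDiffAt_differential {f : M → ℝ} {p : M} (hf : ContMDiffAt 𝓘(ℝ, E) 𝓘(ℝ, ℝ) ∞ f p) :
    ContMDiffAt 𝓘(ℝ, E) (𝓘(ℝ, E).prod 𝓘(ℝ, E →L[ℝ] ℝ)) ∞
      (fun x => Bundle.TotalSpace.mk' (E →L[ℝ] ℝ)
        (E := fun x : M => TangentSpace 𝓘(ℝ, E) x →L[ℝ] Bundle.Trivial M ℝ x) x
        (mvfderiv 𝓘(ℝ, E) f x)) p := by
  have hone := isManifold_one (E := E) (M := M)
  rw [contMDiffAt_hom_bundle]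
  refine ⟨contMDiffAt_id, (hf.mfderiv_const (m := ∞) (by simp)).congr_of_eventuallyEq ?_⟩
  refine Filter.Eventually.of_forall fun x => ?_
  ext v
  simp [inTangentCoordinates, ContinuousLinearMap.inCoordinates]
  rfl

namespace HyperkahlerStructure

variable (S : HyperkahlerStructure E M)

theorem contMDiffAt_dualBivector (i : Fin 3) (p : M) :
    ContMDiffAt 𝓘(ℝ, E) (𝓘(ℝ, E).prod 𝓘(ℝ, (E →L[ℝ] ℝ) →L[ℝ] E)) ∞
      (fun x => Bundle.TotalSpace.mk' ((E →L[ℝ] ℝ) →L[ℝ] E)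
        (E := fun x : M => (TangentSpace 𝓘(ℝ, E) x →L[ℝ] ℝ) →L[ℝ] TangentSpace 𝓘(ℝ, E) x) x
        (dualBivector (S.kahlerForm i x))) p := by
  have : CompleteSpace E := FiniteDimensional.complete ℝ E
  have h1 := contMDiffAt_bundle_comp (F₁ := E) (F₂ := E) (F₃ := E →L[ℝ] ℝ)
    (S.g.contMDiff.contMDiffAt (x := p)) (S.smooth_J i p)
  exact contMDiffAt_bundle_inverse (F₁ := E) (F₂ := E →L[ℝ] ℝ) h1
    (IsHyperhermitian.isInvertible_of_injective ((S.isHyperhermitian p).form_injective i))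

theorem isSmoothBivector_bivectorOf {f : Fin 3 → M → ℝ}
    (hf : ∀ i, ContMDiff 𝓘(ℝ, E) 𝓘(ℝ, ℝ) ∞ (f i)) : IsSmoothBivector (S.bivectorOf f) := by
  refine ⟨fun x => (S.isHyperhermitian x).sum_dualBivector_alternating fun i => f i x, fun x => ?_⟩
  exact ContMDiffAt.sum_section (fun i _ => (hf i x).smul_section (S.contMDiffAt_dualBivector i x))

theorem coefficient_eq (f : Fin 3 → M → ℝ) (i : Fin 3) (x : M) (v : TangentSpace 𝓘(ℝ, E) x) :
    S.g.inner x (S.J i x v) (S.bivectorOf f x (S.g.inner x v)) = -(f i x * S.g.inner x v v) :=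
  (S.isHyperhermitian x).coefficient_eq (fun i => f i x) i v

theorem bivectorOf_injective (hd : Module.finrank ℝ E = 4) {f f' : Fin 3 → M → ℝ}
    (h : S.bivectorOf f = S.bivectorOf f') : f = f' := by
  funext i x
  obtain ⟨v, hv⟩ := (S.isHyperhermitian x).exists_unit hd
  have h1 := S.coefficient_eq f i x v
  rw [h, S.coefficient_eq f' i x v, hv] at h1
  linarith

/-- By `coefficient_eq`, `fᵢ = -g(Jᵢ V, P(g V)) / g(V, V)` for a local smooth field `V` without
zeros. -/
theorem contMDiff_of_isSmoothBivector (hd : Module.finrank ℝ E = 4) {f : Fin 3 → M → ℝ}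
    (hP : IsSmoothBivector (S.bivectorOf f)) (i : Fin 3) :
    ContMDiff 𝓘(ℝ, E) 𝓘(ℝ, ℝ) ∞ (f i) := by
  have : CompleteSpace E := FiniteDimensional.complete ℝ E
  intro p
  obtain ⟨v, hv⟩ := exists_coordField_ne_zero (E := E) (by omega) p
  have hps := mem_chart_source E p
  have hV : SmoothFieldAt (coordField p v) p := contMDiffAt_coordField hps v
  have hgV := ContMDiffAt.clm_bundle_apply (F₁ := E) (F₂ := E →L[ℝ] ℝ)
    (S.g.contMDiff.contMDiffAt (x := p)) hV
  have hPV : SmoothFieldAt (fun x => S.bivectorOf f x (S.g.inner x (coordField p v x))) p :=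
    ContMDiffAt.clm_bundle_apply (F₁ := E →L[ℝ] ℝ) (F₂ := E) (hP.2 p) hgV
  have hnum := contMDiffAt_metric_apply S.g ((S.smooth_J i).apply hV) hPV
  have hg := contMDiffAt_metric_apply S.g hV hV
  have hg0 : S.g.inner p (coordField p v p) (coordField p v p) ≠ 0 :=
    (S.g.pos p _ (hv p hps)).ne'
  refine (hnum.neg.mul (hg.inv₀ hg0)).congr_of_eventuallyEq ?_
  filter_upwards [(chartAt E p).open_source.mem_nhds hps] with x hx
  have h0 : S.g.inner x (coordField p v x) (coordField p v x) ≠ 0 := (S.g.pos x _ (hv x hx)).ne'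
  simp only [Pi.mul_apply, S.coefficient_eq]
  field_simp

theorem exists_eq_bivectorOf (hd : Module.finrank ℝ E = 4)
    {P : ∀ x : M, (TangentSpace 𝓘(ℝ, E) x →L[ℝ] ℝ) →L[ℝ] TangentSpace 𝓘(ℝ, E) x}
    (hP : S.IsHyperPoisson P) : ∃ f : Fin 3 → M → ℝ, P = S.bivectorOf f := by
  choose f hf using fun x => (S.isHyperhermitian x).exists_eq_sum_dualBivector hd
    (hP.smooth.1 x) (hP.mem_component x)
  exact ⟨fun i x => f x i, funext hf⟩

theorem momentMap_apply {X : ∀ x : M, TangentSpace 𝓘(ℝ, E) x} {f : Fin 3 → M → ℝ}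
    (hX : S.AreMomentMaps X f) (i : Fin 3) (x : M) (v : TangentSpace 𝓘(ℝ, E) x) :
    mvfderiv 𝓘(ℝ, E) (f i) x v = S.g.inner x (S.J i x (X x)) v := by
  rw [(hX i).2 x]
  rfl

theorem eq_of_areMomentMaps {X X' : ∀ x : M, TangentSpace 𝓘(ℝ, E) x} {f : Fin 3 → M → ℝ}
    (hX : S.AreMomentMaps X f) (hX' : S.AreMomentMaps X' f) : X = X' := by
  funext x
  refine (S.isHyperhermitian x).form_injective 0 ?_
  exact ((hX 0).2 x).symm.trans ((hX' 0).2 x)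

theorem eq_zero_of_areMomentMaps_const {X : ∀ x : M, TangentSpace 𝓘(ℝ, E) x} {c : Fin 3 → ℝ}
    (hX : S.AreMomentMaps X (fun i _ => c i)) : X = 0 := by
  refine S.eq_of_areMomentMaps hX fun i => ⟨(hX i).1, fun x => ?_⟩
  rw [mvfderiv_const]
  simp

theorem isConstantCombination_of_areMomentMaps_zero [ConnectedSpace M] {f : Fin 3 → M → ℝ}
    (h : S.AreMomentMaps 0 f) : S.IsConstantCombination (S.bivectorOf f) := by
  have : CompleteSpace E := FiniteDimensional.complete ℝ E
  have hc : ∀ i, ∃ c, ∀ x, f i x = c := fun i =>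
    exists_eq_const_of_mvfderiv_eq_zero (h i).1 fun x => by
      rw [(h i).2 x]
      exact map_zero _
  choose c hc using hc
  exact ⟨c, congrArg _ (funext fun i => funext fun x => hc i x)⟩

/-- Moment maps of a vector field define a hyper-Poisson bivector. -/
theorem isHyperPoisson_of_areMomentMaps (hd : Module.finrank ℝ E = 4)
    {X : ∀ x : M, TangentSpace 𝓘(ℝ, E) x} {f : Fin 3 → M → ℝ} (hX : S.AreMomentMaps X f) :
    S.IsHyperPoisson (S.bivectorOf f) := by
  refine ⟨S.isSmoothBivector_bivectorOf fun i => (hX i).1,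
    fun x => (S.isHyperhermitian x).complexify_sum_dualBivector_mem fun i => f i x, ?_⟩
  intro a ha
  obtain ⟨R, hR, rfl⟩ := exists_isFrame ha
  rw [← S.rotate_bivectorOf hR f]
  refine (S.rotate hR).isHolomorphicPoisson hd _ ?_
  have hfun : ∀ i, (fun x => ∑ j, R i j * f j x) =
      fun x => R i 0 * f 0 x + R i 1 * f 1 x + R i 2 * f 2 x := by
    intro i
    funext x
    rw [Fin.sum_univ_three]
  have hsm : ∀ i, ContMDiff 𝓘(ℝ, E) 𝓘(ℝ, ℝ) ∞ (fun x => ∑ j, R i j * f j x) := by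
    intro i
    rw [hfun]
    exact ((contMDiff_const.mul (hX 0).1).add (contMDiff_const.mul (hX 1).1)).add
      (contMDiff_const.mul (hX 2).1)
  -- The rotated functions are moment maps of the same `X` for the rotated triple.
  have hdf : ∀ i x v, mvfderiv 𝓘(ℝ, E) (fun x => ∑ j, R i j * f j x) x v =
      S.g.inner x ((S.rotate hR).J i x (X x)) v := by
    intro i x v
    have hm : ∀ j, MDifferentiableAt 𝓘(ℝ, E) 𝓘(ℝ, ℝ) (f j) x := fun j =>
      (hX j).1.mdifferentiable (by simp) x
    rw [hfun, mvfderiv_linear_combination (hm 0) (hm 1) (hm 2) (R i)]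
    simp only [S.momentMap_apply hX]
    change _ = S.g.inner x (combination (fun i => S.J i x) (R i) (X x)) v
    simp [combination_apply]
  refine ⟨fun x _ => (contMDiffAt_add_I_mul (hsm 1 x) (hsm 2 x)).contMDiffWithinAt,
    fun x _ v => ?_⟩
  have h := (S.rotate hR).hyperhermitian x
  rw [mvfderiv_add_I_mul ((hsm 1).mdifferentiable (by simp) x)
    ((hsm 2).mdifferentiable (by simp) x), mvfderiv_add_I_mul
    ((hsm 1).mdifferentiable (by simp) x) ((hsm 2).mdifferentiable (by simp) x)]
  rw [hdf, hdf, hdf, hdf]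
  -- With `I_a I_b = I_c`, the identities `e1` and `e2` express that `g(I_b X, ·) + i g(I_c X, ·)`
  -- is of type (1,0) for `I_a`.
  have e1 : S.g.inner x ((S.rotate hR).J 1 x (X x)) ((S.rotate hR).J 0 x v) =
      -S.g.inner x ((S.rotate hR).J 2 x (X x)) v := by
    have := h.skew 0 ((S.rotate hR).J 1 x (X x)) v
    rw [h.mul] at this
    exact (neg_eq_iff_eq_neg.2 this).symm
  have e2 : S.g.inner x ((S.rotate hR).J 2 x (X x)) ((S.rotate hR).J 0 x v) =
      S.g.inner x ((S.rotate hR).J 1 x (X x)) v := by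
    have := h.skew 0 ((S.rotate hR).J 2 x (X x)) v
    rw [h.mul_zero_two, map_neg] at this
    exact (neg_injective this).symm
  rw [e1, e2]
  push_cast
  linear_combination (-(S.g.inner x ((S.rotate hR).J 2 x (X x)) v : ℂ)) * Complex.I_sq

/-- The Cauchy-Riemann equations for the coefficients of a hyper-Poisson bivector. -/
theorem cauchyRiemann (hd : Module.finrank ℝ E = 4) {f : Fin 3 → M → ℝ}
    (hP : S.IsHyperPoisson (S.bivectorOf f)) {R : Fin 3 → Fin 3 → ℝ} (hR : IsFrame R)
    {i j k : Fin 3} (h0 : R 0 = Pi.single i 1) (h1 : R 1 = Pi.single j 1)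
    (h2 : R 2 = Pi.single k 1) (x : M) (v : TangentSpace 𝓘(ℝ, E) x) :
    mvfderiv 𝓘(ℝ, E) (f j) x (S.J i x v) = -mvfderiv 𝓘(ℝ, E) (f k) x v := by
  -- Holomorphic coordinates are provided only for the three given structures, so the first vector
  -- of the frame has to be a coordinate vector.
  have hJ : (S.rotate hR).J 0 = S.J i := by
    funext x
    change combination (fun i => S.J i x) (R 0) = S.J i x
    ext v
    rw [h0]
    fin_cases i <;> simp [combination_apply]
  have hp := hP.holomorphicPoisson (R 0) (by simpa [sq] using hR.row 0 0)
  rw [← S.rotate_bivectorOf hR f] at hp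
  have hol := (S.rotate hR).isHolomorphicOn_of_isHolomorphicPoisson hd
    (by rw [hJ]; exact S.integrable i) _ hp
  have hsingle : ∀ (l : Fin 3), (fun x => ∑ j, (Pi.single l 1 : Fin 3 → ℝ) j * f j x) = f l := by
    intro l
    funext x
    rw [Finset.sum_eq_single l]
    · simp
    · intro m _ hm
      simp [hm]
    · simp
  have hcr := hol.2 x trivial v
  have hm : ∀ l, MDifferentiableAt 𝓘(ℝ, E) 𝓘(ℝ, ℝ) (f l) x := fun l =>
    (S.contMDiff_of_isSmoothBivector hd hP.smooth l).mdifferentiable (by simp) x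
  have e : (fun x => (((∑ j, R 1 j * f j x : ℝ)) : ℂ) +
      Complex.I * ((∑ j, R 2 j * f j x : ℝ) : ℂ)) =
      fun x => (f j x : ℂ) + Complex.I * (f k x : ℂ) := by
    funext x
    rw [h1, h2]
    rw [congrFun (hsingle j) x, congrFun (hsingle k) x]
  rw [e, mvfderiv_add_I_mul (hm j) (hm k), mvfderiv_add_I_mul (hm j) (hm k), hJ] at hcr
  have := congrArg Complex.re hcr
  simpa using this

/-- The coefficients of a hyper-Poisson bivector are moment maps of a vector field. -/
theorem exists_areMomentMaps (hd : Module.finrank ℝ E = 4) {f : Fin 3 → M → ℝ}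
    (hP : S.IsHyperPoisson (S.bivectorOf f)) :
    ∃ X, IsSmoothVectorField X ∧ S.AreMomentMaps X f := by
  have hf := S.contMDiff_of_isSmoothBivector hd hP.smooth
  -- Two cyclic permutations of the coordinate frame suffice: `J 2` ties `df₁` to `df₀`, and `J 0`
  -- ties `df₂` to `df₁`.
  have cr1 := S.cauchyRiemann hd hP (R := ![Pi.single 2 1, Pi.single 0 1, Pi.single 1 1])
    (i := 2) (j := 0) (k := 1)
    ⟨by intro i j; fin_cases i <;> fin_cases j <;> simp [Fin.sum_univ_three],
      by simp, by simp, by simp⟩ rfl rfl rfl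
  have cr2 := S.cauchyRiemann hd hP (R := ![Pi.single 0 1, Pi.single 1 1, Pi.single 2 1])
    (i := 0) (j := 1) (k := 2)
    ⟨by intro i j; fin_cases i <;> fin_cases j <;> simp [Fin.sum_univ_three],
      by simp, by simp, by simp⟩ rfl rfl rfl
  let X : ∀ x : M, TangentSpace 𝓘(ℝ, E) x := fun x =>
    dualBivector (S.kahlerForm 0 x) (mvfderiv 𝓘(ℝ, E) (f 0) x)
  have hX0 : ∀ x v, mvfderiv 𝓘(ℝ, E) (f 0) x v = S.g.inner x (S.J 0 x (X x)) v := by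
    intro x v
    have h := S.isHyperhermitian x
    obtain ⟨b, hb⟩ := h.exists_flat (mvfderiv 𝓘(ℝ, E) (f 0) x)
    have hXx : X x = -S.J 0 x b := by
      change dualBivector ((S.g.inner x).comp (S.J 0 x)) (mvfderiv 𝓘(ℝ, E) (f 0) x) = _
      rw [← hb]
      exact h.dualBivector_flat 0 b
    rw [hXx, map_neg, S.J_sq, neg_neg, hb]
  -- Here `df₁ = -df₀ ∘ J₂ = -g(J₀ X, J₂ ·) = g(J₂ J₀ X, ·)` and `J₂ J₀ = J₁`; the third moment map
  -- follows in the same way from `J₀ J₁ = J₂`.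
  have hX1 : ∀ x v, mvfderiv 𝓘(ℝ, E) (f 1) x v = S.g.inner x (S.J 1 x (X x)) v := by
    intro x v
    have h := S.isHyperhermitian x
    have h1 := cr1 x v
    have h2 := h.skew 2 (S.J 0 x (X x)) v
    rw [h.mul_two_zero] at h2
    rw [hX0] at h1
    linarith
  have hX2 : ∀ x v, mvfderiv 𝓘(ℝ, E) (f 2) x v = S.g.inner x (S.J 2 x (X x)) v := by
    intro x v
    have h := S.isHyperhermitian x
    have h1 := cr2 x v
    have h2 := h.skew 0 (S.J 1 x (X x)) v
    rw [h.mul] at h2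
    rw [hX1] at h1
    linarith
  refine ⟨X, fun p => ContMDiffAt.clm_bundle_apply (F₁ := E →L[ℝ] ℝ) (F₂ := E)
    (S.contMDiffAt_dualBivector 0 p) (contMDiffAt_differential (hf 0 p)), fun i => ⟨hf i, ?_⟩⟩
  intro x
  ext v
  fin_cases i
  · exact hX0 x v
  · exact hX1 x v
  · exact hX2 x v

end HyperkahlerStructure

end Hyperkahler

end HyperPoisson

end

theorem mainTheorem6 {M : Type*} [TopologicalSpace M] [T2Space M] [SecondCountableTopology M]
    [ConnectedSpace M] [ChartedSpace (EuclideanSpace ℝ (Fin 4)) M]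
    [IsManifold 𝓘(ℝ, EuclideanSpace ℝ (Fin 4)) ∞ M]
    (S : HyperPoisson.HyperkahlerStructure (EuclideanSpace ℝ (Fin 4)) M) :
    ((∃ P, S.IsHyperPoisson P ∧ ¬ S.IsConstantCombination P) ↔
      ∃ X, S.IsTriHamiltonian X ∧ X ≠ 0) ∧
    (∀ P, S.IsHyperPoisson P → ¬ S.IsConstantCombination P →
      (∃! f : Fin 3 → M → ℝ, P = S.bivectorOf f) ∧
      ∀ f : Fin 3 → M → ℝ, P = S.bivectorOf f →
        ∃! X, S.IsTriHamiltonian X ∧ X ≠ 0 ∧ S.AreMomentMaps X f) ∧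
    (∀ X, S.IsTriHamiltonian X → X ≠ 0 → ∀ f : Fin 3 → M → ℝ, S.AreMomentMaps X f →
      S.IsHyperPoisson (S.bivectorOf f) ∧ ¬ S.IsConstantCombination (S.bivectorOf f)) := by
  have hd : Module.finrank ℝ (EuclideanSpace ℝ (Fin 4)) = 4 := by simp
  have forward : ∀ P, S.IsHyperPoisson P → ¬ S.IsConstantCombination P →
      (∃! f : Fin 3 → M → ℝ, P = S.bivectorOf f) ∧
      ∀ f : Fin 3 → M → ℝ, P = S.bivectorOf f →
        ∃! X, S.IsTriHamiltonian X ∧ X ≠ 0 ∧ S.AreMomentMaps X f := by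
    intro P hP hc
    refine ⟨?_, ?_⟩
    · obtain ⟨f, hf⟩ := S.exists_eq_bivectorOf hd hP
      exact ⟨f, hf, fun f' hf' => S.bivectorOf_injective hd (hf'.symm.trans hf)⟩
    · rintro f rfl
      obtain ⟨X, hXs, hX⟩ := S.exists_areMomentMaps hd hP
      refine ⟨X, ⟨⟨hXs, f, hX⟩, ?_, hX⟩, fun X' hX' => S.eq_of_areMomentMaps hX'.2.2 hX⟩
      rintro rfl
      exact hc (S.isConstantCombination_of_areMomentMaps_zero hX)
  have backward : ∀ X, S.IsTriHamiltonian X → X ≠ 0 → ∀ f : Fin 3 → M → ℝ, S.AreMomentMaps X f →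
      S.IsHyperPoisson (S.bivectorOf f) ∧ ¬ S.IsConstantCombination (S.bivectorOf f) := by
    intro X _ hX0 f hX
    refine ⟨S.isHyperPoisson_of_areMomentMaps hd hX, ?_⟩
    rintro ⟨c, hc⟩
    -- Uniqueness of coefficients makes the moment maps constant, so `X` vanishes.
    obtain rfl := S.bivectorOf_injective hd hc
    exact hX0 (S.eq_zero_of_areMomentMaps_const hX)
  refine ⟨⟨?_, ?_⟩, forward, backward⟩
  · rintro ⟨P, hP, hc⟩
    obtain ⟨⟨f, hf, _⟩, h⟩ := forward P hP hc
    obtain ⟨X, hX, _⟩ := h f hf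
    exact ⟨X, hX.1, hX.2.1⟩
  · rintro ⟨X, hX, hX0⟩
    obtain ⟨f, hf⟩ := hX.2
    exact ⟨S.bivectorOf f, backward X hX hX0 f hf⟩
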